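/- **Setting.** A Bratteli diagram $B=(V,E)$ consists of finite vertex sets $V_n$ ($n\ge 0$), with $V_0=\{v_0\}$ a single point, and finite edge sets $E_{n+1}$ from level $n$ to level $n+1$ ($n\ge0$), with source and range maps $s:E_{n+1}\to V_n$ and $r:E_{n+1}\to V_{n+1}$ that are both surjective. Its incidence matrices $F_n$ ($n\ge 0$) have entries $f^{(n)}_{v,w}=|\{e\in E_{n+1}: r(e)=v,\ s(e)=w\}|$, $v\in V_{n+1}$, $w\in V_n$. The path space $X_B$ is the set of infinite paths starting at $v_0$, with the topology generated by cylinder sets. Two paths are tail equivalent, $(x,y)\in\mathcal E$, if they agree from some level on. A Borel measure $\mu$ on $X_B$ is $\mathcal E$-invariant if $T_*\mu=\mu$ for every Borel automorphism $T$ of $X_B$ with $(x,Tx)\in\mathcal E$ for all $x$. The diagram $B$ is simple if for every $n$ there is $m>n$ such that every vertex of $V_n$ is joined by a path to every vertex of $V_m$. It is stationary with incidence matrix $F$ if all the sets $V_n$, $n\ge1$, are identified with one index set so that $F_n=F$ for all $n\ge 1$. An edge subdiagram $\overline B$ of $B$ keeps all vertices and a subset of the edges at each level, in such a way that any two vertices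 joined by an edge of $B$ remain joined by an edge of $\overline B$. If $B$ is stationary, $\overline B$ is stationary with incidence matrix $\overline F$ if $\overline F_n=\overline F$ for all $n\ge1$, and it is then called proper if $\overline F\neq F$ (so that $\overline F\le F$ entrywise with some strict inequality). A vertex subdiagram of $B$ is given by proper subsets $W_n\subsetneq V_n$, $n\ge1$ (together with $W_0=V_0$), and has all edges of $B$ whose source and range lie in these sets; if $B$ is stationary, it is called stationary if $W_n$ is the same subset of the index set for all $n\ge1$. In both cases $X_{\overline B}\subset X_B$ is the set of paths all of whose edges belong to $\overline B$. **Proposition.** Let $B$ be a stationary Bratteli diagram with irreducible incidence matrix $F$. There exists an $\mathcal E$-invariant Borel probability measure on $X_B$, and it is unique if $B$ is simple (equivalently, if $F$ is primitive). Moreover, for every $\mathcal E$-invariant Borel probability measure $\mu$ on $X_B$: 1. $\mu(X_{\overline B})=0$ for every proper stationary edge subdiagram $\overline B$ of $B$; 2. $\mu(X_{\overline B})=0$ for every stationary vertex subdiagram $\overline B$ of $B$; 3. if $B$ is simple, $\mu(X_{\overline B})=0$ for every vertex subdiagram $\overline B$ of $B$, stationary or not. -/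

import Mathlib

open MeasureTheory

universe u v w

/-- A Bratteli diagram. `V n` is the set of vertices of level `n` and `E n` is the set of edges
from level `n` to level `n + 1` (usually written `E_{n+1}`); `s` and `r` are the source and range
maps. All levels are finite, `V 0` is a single point, every vertex emits an edge and every vertex
of positive level receives an edge. -/
structure BratteliDiagram where
  V : ℕ → Type u
  E : ℕ → Type v
  finite_V : ∀ n, Finite (V n)
  finite_E : ∀ n, Finite (E n)
  s : ∀ {n}, E n → V n
  r : ∀ {n}, E n → V (n + 1)
  root : V 0
  eq_root : ∀ x : V 0, x = root
  s_surjective : ∀ n, Function.Surjective (s : E n → V n)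
  r_surjective : ∀ n, Function.Surjective (r : E n → V (n + 1))

namespace BratteliDiagram

/-- The incidence matrices `F_n`, `n ≥ 0`: the entry at `(x, y)`, for `x` of level `n + 1` and
`y` of level `n`, is the number of edges from `y` to `x`. -/
noncomputable def incidence (B : BratteliDiagram.{u, v}) (n : ℕ) :
    Matrix (B.V (n + 1)) (B.V n) ℕ :=
  fun x y => Set.ncard {e : B.E n | B.r e = x ∧ B.s e = y}

/-- `B.Joined x y`: there is a finite (possibly trivial) path of `B` from the vertex `x` down to
the vertex `y`. -/
inductive Joined (B : BratteliDiagram.{u, v}) {n : ℕ} (x : B.V n) : ∀ {m : ℕ}, B.V m → Prop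
  | refl : Joined B x x
  | step {m : ℕ} (e : B.E m) : Joined B x (B.s e) → Joined B x (B.r e)

/-- `B` is simple: for every level `n` there is a level `m > n` such that every vertex of level
`n` is joined by a path to every vertex of level `m`. -/
def IsSimple (B : BratteliDiagram.{u, v}) : Prop :=
  ∀ n, ∃ m, n < m ∧ ∀ (x : B.V n) (y : B.V m), B.Joined x y

/-! ### The path space -/

/-- The infinite paths of `B` (they start at the unique vertex of level `0`). -/
def PathSpace (B : BratteliDiagram.{u, v}) : Type v :=
  {x : ∀ n, B.E n // ∀ n, B.r (x n) = B.s (x (n + 1))}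

instance (B : BratteliDiagram.{u, v}) (n : ℕ) : TopologicalSpace (B.E n) := ⊥

instance (B : BratteliDiagram.{u, v}) (n : ℕ) : DiscreteTopology (B.E n) := ⟨rfl⟩

/-- The topology of the path space, which has the cylinder sets as a basis: the one induced by
the product of the discrete topologies. -/
instance (B : BratteliDiagram.{u, v}) : TopologicalSpace B.PathSpace :=
  inferInstanceAs (TopologicalSpace {x : ∀ n, B.E n // ∀ n, B.r (x n) = B.s (x (n + 1))})

/-- The path space carries its Borel sigma-algebra. -/
instance (B : BratteliDiagram.{u, v}) : MeasurableSpace B.PathSpace := borel B.PathSpace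

instance (B : BratteliDiagram.{u, v}) : BorelSpace B.PathSpace := ⟨rfl⟩

/-- The tail equivalence relation: two paths agree from some level on. -/
def TailEquiv (B : BratteliDiagram.{u, v}) (x y : B.PathSpace) : Prop :=
  ∃ n, ∀ i, n ≤ i → x.1 i = y.1 i

/-- A Borel measure is invariant with respect to the tail equivalence relation if it is preserved
by every Borel automorphism of the path space that moves each path inside its tail equivalence
class. -/
def IsTailInvariant (B : BratteliDiagram.{u, v}) (μ : Measure B.PathSpace) : Prop :=
  ∀ T : B.PathSpace ≃ᵐ B.PathSpace, (∀ x, B.TailEquiv x (T x)) → μ.map T = μ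

/-- `μ` is a probability measure on `B`: a Borel probability measure on the path space that is
invariant with respect to the tail equivalence relation. -/
def IsInvariantProb (B : BratteliDiagram.{u, v}) (μ : Measure B.PathSpace) : Prop :=
  IsProbabilityMeasure μ ∧ B.IsTailInvariant μ

/-! ### Stationary diagrams -/

/-- `B` is stationary with incidence matrix `F`: the vertex sets of all levels `n ≥ 1` are
identified with one index set `ι`, and in this identification all the incidence matrices
`F_1, F_2, …` are equal to `F`. -/
structure Stationary (B : BratteliDiagram.{u, v}) {ι : Type w} (F : Matrix ι ι ℕ) where
  label : ∀ n, B.V (n + 1) ≃ ι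
  incidence_eq : ∀ n (x : B.V (n + 2)) (y : B.V (n + 1)),
    B.incidence (n + 1) x y = F (label (n + 1) x) (label n y)

/-! ### Subdiagrams -/

/-- An edge subdiagram of `B`: it has all the vertices of `B`, and some of the edges, and two
vertices of consecutive levels that are joined by an edge of `B` are still joined by a
remaining edge. -/
structure EdgeSubdiagram (B : BratteliDiagram.{u, v}) where
  edges : ∀ n, Set (B.E n)
  exists_edge : ∀ n (e : B.E n), ∃ e' ∈ edges n, B.s e' = B.s e ∧ B.r e' = B.r e

namespace EdgeSubdiagram

variable {B : BratteliDiagram.{u, v}}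

/-- The incidence matrices of an edge subdiagram. -/
noncomputable def incidence (S : B.EdgeSubdiagram) (n : ℕ) : Matrix (B.V (n + 1)) (B.V n) ℕ :=
  fun x y => Set.ncard {e : B.E n | e ∈ S.edges n ∧ B.r e = x ∧ B.s e = y}

/-- The path space of an edge subdiagram, as a subset of the path space of `B`. -/
def pathSpace (S : B.EdgeSubdiagram) : Set B.PathSpace :=
  {x | ∀ n, x.1 n ∈ S.edges n}

/-- The edge subdiagram `S` of the stationary diagram `B` is stationary with incidence matrix
`F'`: from level `1` on, its incidence matrices are all equal to `F'` (in the same identification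
of the vertex sets). -/
def IsStationary {ι : Type w} {F : Matrix ι ι ℕ} (S : B.EdgeSubdiagram) (hB : B.Stationary F)
    (F' : Matrix ι ι ℕ) : Prop :=
  ∀ n (x : B.V (n + 2)) (y : B.V (n + 1)),
    S.incidence (n + 1) x y = F' (hB.label (n + 1) x) (hB.label n y)

end EdgeSubdiagram

/-- A vertex subdiagram of `B`, given by a sequence of proper subsets `W n` of the vertex sets
`V n`, `n ≥ 1`; the vertex of level `0` is kept. -/
structure VertexSubdiagram (B : BratteliDiagram.{u, v}) where
  W : ∀ n, Set (B.V n)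
  W_zero : W 0 = Set.univ
  W_ne_univ : ∀ n, W (n + 1) ≠ Set.univ

namespace VertexSubdiagram

variable {B : BratteliDiagram.{u, v}}

/-- The edges of a vertex subdiagram: all edges of `B` whose source and range both belong to the
chosen vertices. -/
def edges (S : B.VertexSubdiagram) (n : ℕ) : Set (B.E n) :=
  {e | B.s e ∈ S.W n ∧ B.r e ∈ S.W (n + 1)}

/-- The path space of a vertex subdiagram, as a subset of the path space of `B`. -/
def pathSpace (S : B.VertexSubdiagram) : Set B.PathSpace :=
  {x | ∀ n, x.1 n ∈ S.edges n}

/-- The vertex subdiagram `S` of the stationary diagram `B` is stationary: the sets `W n`,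
`n ≥ 1`, are all equal to one set of labels. -/
def IsStationary {ι : Type w} {F : Matrix ι ι ℕ} (S : B.VertexSubdiagram)
    (hB : B.Stationary F) : Prop :=
  ∃ W' : Set ι, ∀ n, S.W (n + 1) = hB.label n ⁻¹' W'

end VertexSubdiagram

end BratteliDiagram

/-! Exchanging initial segments that end in a common vertex is a Borel automorphism inside tail
classes. Hence an invariant `μ` gives all cylinders ending in a vertex `z` of level `n` the same
mass `q n z`. With `h n z` the number of paths from the root to `z`, the measure is encoded by `q n
= q (n + 1) F` and `∑ h n z * q n z = 1`. If `k n z` counts only the paths with edges in `A`, the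
paths staying in `A` have mass at most `∑ k n z * q n z`; they form a null set once, for every `ε >
0`, `k n ≤ ε * h n` for some `n`.

What remains is linear algebra. For stationary subdiagrams `k (n + 1) = M k n` with `M ≤ F`, `M ≠
F`; irreducibility makes `k` grow at a strictly smaller rate (`exists_growth_le`). A stationary
vertex subdiagram is the case where entries of `F` are set to zero. For a simple diagram `F ^ K ≥ 1`
entrywise, and a vertex omitted at each level costs a fixed proportion of the paths every `K` levels
(`exists_growth_le_of_exists_zero`). The same positivity forces two normalized solutions `q`, `q'`
to coincide (`le_of_vecMul_recursion`), which is uniqueness. Existence is a compactness argument: a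
limit of uniform measures on the paths that agree with a fixed one from level `n` on. -/

namespace Matrix

/-! ### Perron–Frobenius theory and growth estimates for nonnegative matrices -/

section Nonneg

variable {ι : Type*} [Fintype ι]

lemma mulVec_nonneg_of_nonneg {A : Matrix ι ι ℝ} (hA : ∀ i j, 0 ≤ A i j) {x : ι → ℝ}
    (hx : ∀ i, 0 ≤ x i) (i : ι) : 0 ≤ (A *ᵥ x) i :=
  Finset.sum_nonneg fun j _ => mul_nonneg (hA i j) (hx j)

lemma mulVec_le_mulVec_of_nonneg {A : Matrix ι ι ℝ} (hA : ∀ i j, 0 ≤ A i j) {x y : ι → ℝ}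
    (hxy : ∀ i, x i ≤ y i) (i : ι) : (A *ᵥ x) i ≤ (A *ᵥ y) i :=
  Finset.sum_le_sum fun j _ => mul_le_mul_of_nonneg_left (hxy j) (hA i j)

lemma mulVec_pos_of_pos {P : Matrix ι ι ℝ} (hP : ∀ i j, 0 < P i j) {x : ι → ℝ}
    (hx : ∀ i, 0 ≤ x i) (hx0 : ∃ i, 0 < x i) (i : ι) : 0 < (P *ᵥ x) i := by
  obtain ⟨j, hj⟩ := hx0
  exact Finset.sum_pos' (fun k _ => mul_nonneg (hP i k).le (hx k))
    ⟨j, Finset.mem_univ j, mul_pos (hP i j) hj⟩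

/-- A nonnegative matrix that commutes with an entrywise positive matrix has a positive
eigenvector (Perron–Frobenius). -/
theorem exists_pos_eigenvector [Nonempty ι] {A P : Matrix ι ι ℝ} (hA : ∀ i j, 0 ≤ A i j)
    (hP : ∀ i j, 0 < P i j) (hPA : P * A = A * P) :
    ∃ (l : ℝ) (x : ι → ℝ), (∀ i, 0 < x i) ∧ A *ᵥ x = l • x := by
  classical
  -- Collatz–Wielandt: the eigenvalue is the largest `r` with `r x ≤ A x` for some `x` in the
  -- simplex. The bound on `r` is automatic and makes `S` compact.
  let S : Set (ℝ × (ι → ℝ)) :=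
    (Set.Icc 0 (∑ i, ∑ j, A i j) ×ˢ stdSimplex ℝ ι) ∩ {p | ∀ i, p.1 * p.2 i ≤ (A *ᵥ p.2) i}
  have hSc : IsCompact S := by
    refine (isCompact_Icc.prod (isCompact_stdSimplex ℝ ι)).inter_right ?_
    simp only [Set.ofPred_forall, Matrix.mulVec, dotProduct]
    exact isClosed_iInter fun i => isClosed_le (by fun_prop) (by fun_prop)
  have hmem : ∀ (r : ℝ) (x : ι → ℝ), 0 ≤ r → x ∈ stdSimplex ℝ ι →
      (∀ i, r * x i ≤ (A *ᵥ x) i) → (r, x) ∈ S := by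
    intro r x hr hx h
    refine ⟨⟨⟨hr, ?_⟩, hx⟩, h⟩
    have hx1 : ∀ j, x j ≤ 1 := fun j => hx.2 ▸
      Finset.single_le_sum (fun k _ => hx.1 k) (Finset.mem_univ j)
    calc r = ∑ i, r * x i := by rw [← Finset.mul_sum, hx.2, mul_one]
      _ ≤ ∑ i, (A *ᵥ x) i := Finset.sum_le_sum fun i _ => h i
      _ ≤ ∑ i, ∑ j, A i j := Finset.sum_le_sum fun i _ => Finset.sum_le_sum fun j _ =>
          mul_le_of_le_one_right (hA i j) (hx1 j)
  have hSne : S.Nonempty := by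
    obtain ⟨i⟩ := ‹Nonempty ι›
    have hx : Pi.single i 1 ∈ stdSimplex ℝ ι := single_mem_stdSimplex ℝ i
    exact ⟨_, hmem 0 _ le_rfl hx fun j => by
      rw [zero_mul]; exact mulVec_nonneg_of_nonneg hA hx.1 j⟩
  obtain ⟨⟨l, x⟩, hlx, hmax⟩ := hSc.exists_isMaxOn hSne continuous_fst.continuousOn
  obtain ⟨⟨⟨hl0, -⟩, hx⟩, hle⟩ := hlx
  simp only [Set.mem_ofPred_eq] at hle hl0 hx
  have hx0 : ∃ i, 0 < x i := by
    by_contra! h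
    have : ∑ i, x i ≤ 0 := Finset.sum_nonpos fun i _ => h i
    rw [hx.2] at this
    linarith
  have hPx := mulVec_pos_of_pos hP hx.1 hx0
  have hcomm : A *ᵥ (P *ᵥ x) - l • (P *ᵥ x) = P *ᵥ (A *ᵥ x - l • x) := by
    rw [mulVec_sub, mulVec_mulVec, mulVec_mulVec, hPA, mulVec_smul]
  refine ⟨l, P *ᵥ x, hPx, ?_⟩
  -- Otherwise `P` turns the inequality `l x ≤ A x`, strict somewhere, into one for `P x` that is
  -- strict everywhere, and normalizing `P x` beats the maximum `l`.
  by_contra hne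
  have hz0 : ∃ i, 0 < (A *ᵥ x - l • x) i := by
    by_contra! h
    have : A *ᵥ x - l • x = 0 := by
      funext i
      refine le_antisymm (h i) ?_
      have := hle i
      simp only [Pi.sub_apply, Pi.smul_apply, smul_eq_mul, Pi.zero_apply]
      linarith
    rw [this, mulVec_zero] at hcomm
    exact hne (sub_eq_zero.1 hcomm)
  have hpos := mulVec_pos_of_pos hP (x := A *ᵥ x - l • x)
    (fun i => by simpa using hle i) hz0
  rw [← hcomm] at hpos
  set y := P *ᵥ x with hy
  obtain ⟨i₀, hi₀⟩ := Finite.exists_min fun i => (A *ᵥ y) i / y i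
  have hl' : l < (A *ᵥ y) i₀ / y i₀ := by
    rw [lt_div_iff₀ (hPx i₀)]
    simpa using hpos i₀
  have hs : 0 < ∑ i, y i := Finset.sum_pos (fun i _ => hPx i) Finset.univ_nonempty
  have hS := hmem ((A *ᵥ y) i₀ / y i₀) ((∑ i, y i)⁻¹ • y) (hl0.trans hl'.le)
    ⟨fun i => by have := (hPx i).le; simp only [Pi.smul_apply, smul_eq_mul]; positivity, by
      simp only [Pi.smul_apply, smul_eq_mul]
      rw [← Finset.mul_sum, inv_mul_cancel₀ hs.ne']⟩
    (fun i => by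
      rw [mulVec_smul, Pi.smul_apply, Pi.smul_apply, smul_eq_mul, smul_eq_mul, mul_left_comm]
      exact mul_le_mul_of_nonneg_left ((le_div_iff₀ (hPx i)).1 (hi₀ i)) (inv_nonneg.2 hs.le))
  exact absurd (hmax hS) (not_le.2 hl')

/-- The bound `2 ≤ M` ensures `(M ^ 2)⁻¹ < 1` where this is used as a contraction constant. -/
lemma exists_entry_le (P : Matrix ι ι ℝ) : ∃ M : ℝ, 2 ≤ M ∧ ∀ i j, P i j ≤ M := by
  obtain ⟨M, hM⟩ := (Set.finite_range fun p : ι × ι => P p.1 p.2).bddAbove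
  exact ⟨max 2 M, le_max_left _ _, fun i j =>
    (hM ⟨(i, j), rfl⟩).trans (le_max_right _ _)⟩

/-- The image of a nonnegative vector under a matrix with entries in `[1, M]` has comparable
entries. -/
lemma mulVec_mem_Icc {P : Matrix ι ι ℝ} {M : ℝ} (hP1 : ∀ i j, 1 ≤ P i j)
    (hPM : ∀ i j, P i j ≤ M) {x : ι → ℝ} (hx : ∀ i, 0 ≤ x i) (i : ι) :
    (P *ᵥ x) i ∈ Set.Icc (∑ j, x j) (M * ∑ j, x j) := by
  simp only [mulVec, dotProduct, Finset.mul_sum]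
  exact ⟨Finset.sum_le_sum fun j _ => le_mul_of_one_le_left (hx j) (hP1 i j),
    Finset.sum_le_sum fun j _ => mul_le_mul_of_nonneg_right (hPM i j) (hx j)⟩

variable [DecidableEq ι]

lemma pow_apply_le_pow_apply {A B : Matrix ι ι ℝ} (hA : ∀ i j, 0 ≤ A i j)
    (hAB : ∀ i j, A i j ≤ B i j) (k : ℕ) (i j : ι) : (A ^ k) i j ≤ (B ^ k) i j := by
  induction k generalizing i j with
  | zero => simp
  | succ k ih =>
    rw [pow_succ, pow_succ, mul_apply, mul_apply]
    exact Finset.sum_le_sum fun l _ => mul_le_mul (ih i l) (hAB l j) (hA l j)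
      ((pow_apply_nonneg hA k i l).trans (ih i l))

/-- Each entry is positive in some power, so a sum of enough powers is positive, and a polynomial in
`A` commutes with `A`. Multiplication by `P` makes inequalities strict everywhere without assuming
primitivity. -/
lemma IsIrreducible.exists_pos_commute {A : Matrix ι ι ℝ} (hA : A.IsIrreducible) :
    ∃ P : Matrix ι ι ℝ, (∀ i j, 0 < P i j) ∧ P * A = A * P := by
  choose k _ hk using (isIrreducible_iff_exists_pow_pos hA.nonneg).1 hA
  let N := ∑ i, ∑ j, k i j
  refine ⟨∑ n ∈ Finset.range (N + 1), A ^ n, fun i j => ?_, ?_⟩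
  · rw [sum_apply]
    refine Finset.sum_pos' (fun n _ => pow_apply_nonneg hA.nonneg n i j)
      ⟨k i j, Finset.mem_range.2 (Nat.lt_succ_of_le ?_), hk i j⟩
    exact (Finset.single_le_sum (f := k i) (fun _ _ => Nat.zero_le _) (Finset.mem_univ j)).trans
      (Finset.single_le_sum (f := fun i => ∑ j, k i j) (fun _ _ => Nat.zero_le _)
        (Finset.mem_univ i))
  · rw [Finset.sum_mul, Finset.mul_sum]
    exact Finset.sum_congr rfl fun n _ => (pow_succ A n).symm.trans (pow_succ' A n)

/-- A positive entry of `A ^ k` survives in `B ^ k` up to a factor `2 ^ k`. -/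
lemma IsIrreducible.of_half_le {A B : Matrix ι ι ℝ} (hA : A.IsIrreducible)
    (hAB : ∀ i j, A i j / 2 ≤ B i j) : B.IsIrreducible := by
  have h0 : ∀ i j, 0 ≤ ((1 / 2 : ℝ) • A) i j := fun i j => by
    have := hA.nonneg i j
    rw [smul_apply, smul_eq_mul]; positivity
  have hle : ∀ i j, ((1 / 2 : ℝ) • A) i j ≤ B i j := fun i j => by
    rw [smul_apply, smul_eq_mul]; linarith [hAB i j]
  rw [isIrreducible_iff_exists_pow_pos fun i j => (h0 i j).trans (hle i j)]
  intro i j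
  obtain ⟨k, hk, hpos⟩ := (isIrreducible_iff_exists_pow_pos hA.nonneg).1 hA i j
  refine ⟨k, hk, lt_of_lt_of_le ?_ (pow_apply_le_pow_apply h0 hle k i j)⟩
  rw [smul_pow, smul_apply, smul_eq_mul]
  positivity

/-- If `A ≤ F` entrywise and `A ≠ F` with `F` irreducible, the growth of `A ^ n` is negligible
with respect to that of `F ^ n`. -/
theorem IsIrreducible.exists_growth_le [Nonempty ι] {A F : Matrix ι ι ℝ} (hF : F.IsIrreducible)
    (hA : ∀ i j, 0 ≤ A i j) (hAF : ∀ i j, A i j ≤ F i j) (hne : A ≠ F) {k h : ℕ → ι → ℝ}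
    (hk : ∀ n, k (n + 1) = A *ᵥ k n) (hh : ∀ n, h (n + 1) = F *ᵥ h n)
    (hh0 : ∀ i, 0 < h 0 i) {ε : ℝ} (hε : 0 < ε) : ∃ n, ∀ i, k n i ≤ ε * h n i := by
  -- `A` itself may be reducible; the average `G` is irreducible, lies between `A` and `F`, and
  -- still differs from `F`.
  let G : Matrix ι ι ℝ := fun i j => (A i j + F i j) / 2
  have hG : G.IsIrreducible := hF.of_half_le fun i j => by
    have := hA i j
    simp only [G]; linarith
  obtain ⟨P, hP, hPF⟩ := hF.exists_pos_commute
  obtain ⟨l, x, hx, hFx⟩ := exists_pos_eigenvector hF.nonneg hP hPF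
  obtain ⟨Q, hQ, hQG⟩ := hG.exists_pos_commute
  -- `G x ≤ l x` with strict inequality somewhere; since `Q` is positive and commutes with `G`, `G y
  -- < l y` everywhere.
  set y := Q *ᵥ x with hy_def
  have hy : ∀ i, 0 < y i :=
    mulVec_pos_of_pos hQ (fun i => (hx i).le) ⟨Classical.arbitrary ι, hx _⟩
  have hdiff : l • y - G *ᵥ y = Q *ᵥ (l • x - G *ᵥ x) := by
    rw [mulVec_sub, hy_def, mulVec_mulVec, mulVec_mulVec, hQG, mulVec_smul]
  have hz : ∀ i, (l • x - G *ᵥ x) i = ∑ j, (F i j - A i j) / 2 * x j := by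
    intro i
    rw [← hFx, Pi.sub_apply]
    simp only [mulVec, dotProduct, G]
    rw [← Finset.sum_sub_distrib]
    exact Finset.sum_congr rfl fun j _ => by ring
  have hterm : ∀ i j, 0 ≤ (F i j - A i j) / 2 * x j := fun i j =>
    mul_nonneg (by linarith [hAF i j]) (hx j).le
  have hGy : ∀ i, (G *ᵥ y) i < l * y i := by
    have hpos := mulVec_pos_of_pos hQ (x := l • x - G *ᵥ x)
      (fun i => by rw [hz]; exact Finset.sum_nonneg fun j _ => hterm i j) (by
        obtain ⟨i, j, hij⟩ : ∃ i j, A i j ≠ F i j := by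
          by_contra! h
          exact hne (Matrix.ext h)
        refine ⟨i, ?_⟩
        rw [hz]
        refine Finset.sum_pos' (fun j _ => hterm i j) ⟨j, Finset.mem_univ j, ?_⟩
        have := lt_of_le_of_ne (hAF i j) hij
        exact mul_pos (by linarith) (hx j))
    intro i
    have := hpos i
    rw [← hdiff] at this
    simpa using this
  have hAG : ∀ i j, A i j ≤ G i j := fun i j => by
    have := hAF i j
    simp only [G]; linarith
  obtain ⟨i₀, hi₀⟩ := Finite.exists_max fun i => (G *ᵥ y) i / y i
  -- Thus `A y ≤ t y` with `t < l`: `k n` is at most of order `t ^ n`, while `h n` is at least of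
  -- order `l ^ n`.
  set t := (G *ᵥ y) i₀ / y i₀ with ht_def
  have htl : t < l := (div_lt_iff₀ (hy i₀)).2 (hGy i₀)
  have ht0 : 0 ≤ t :=
    div_nonneg (mulVec_nonneg_of_nonneg hG.nonneg (fun i => (hy i).le) i₀) (hy i₀).le
  have hAy : ∀ i, (A *ᵥ y) i ≤ t * y i := fun i =>
    (Finset.sum_le_sum fun j _ => mul_le_mul_of_nonneg_right (hAG i j) (hy j).le).trans
      ((div_le_iff₀ (hy i)).1 (hi₀ i))
  have hl : 0 < l := ht0.trans_lt htl
  obtain ⟨i₁, hi₁⟩ := Finite.exists_max fun i => k 0 i / y i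
  obtain ⟨i₂, hi₂⟩ := Finite.exists_min fun i => h 0 i / x i
  obtain ⟨i₃, hi₃⟩ := Finite.exists_max fun i => y i / x i
  -- The maximum with `0` is needed because `k 0` may be negative.
  set C := max (k 0 i₁ / y i₁) 0 with hC
  set c := h 0 i₂ / x i₂ with hc
  set D := y i₃ / x i₃ with hD
  have hC0 : 0 ≤ C := le_max_right _ _
  have hc0 : 0 < c := div_pos (hh0 _) (hx _)
  have hD0 : 0 < D := div_pos (hy _) (hx _)
  have hkn : ∀ n i, k n i ≤ C * t ^ n * y i := by
    intro n
    induction n with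
    | zero =>
      intro i
      rw [pow_zero, mul_one]
      exact (div_le_iff₀ (hy i)).1 ((hi₁ i).trans (le_max_left _ _))
    | succ n ih =>
      intro i
      rw [hk]
      calc (A *ᵥ k n) i ≤ (A *ᵥ ((C * t ^ n) • y)) i := mulVec_le_mulVec_of_nonneg hA ih i
        _ = C * t ^ n * (A *ᵥ y) i := by rw [mulVec_smul, Pi.smul_apply, smul_eq_mul]
        _ ≤ C * t ^ n * (t * y i) := mul_le_mul_of_nonneg_left (hAy i) (by positivity)
        _ = C * t ^ (n + 1) * y i := by ring
  have hhn : ∀ n i, c * l ^ n * x i ≤ h n i := by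
    intro n
    induction n with
    | zero =>
      intro i
      rw [pow_zero, mul_one]
      exact (le_div_iff₀ (hx i)).1 (hi₂ i)
    | succ n ih =>
      intro i
      rw [hh]
      calc c * l ^ (n + 1) * x i = c * l ^ n * (l • x) i := by
            simp only [Pi.smul_apply, smul_eq_mul]; ring
        _ = (F *ᵥ ((c * l ^ n) • x)) i := by
            simp only [mulVec_smul, hFx, Pi.smul_apply, smul_eq_mul]
        _ ≤ (F *ᵥ h n) i := mulVec_le_mulVec_of_nonneg hF.nonneg ih i
  have hlim : Filter.Tendsto (fun n : ℕ => C * D / c * (t / l) ^ n) Filter.atTop (nhds 0) := by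
    simpa using (tendsto_pow_atTop_nhds_zero_of_lt_one (div_nonneg ht0 hl.le)
      ((div_lt_one hl).2 htl)).const_mul (C * D / c)
  obtain ⟨n, hn⟩ := (hlim.eventually_le_const hε).exists
  refine ⟨n, fun i => ?_⟩
  have hyx : y i ≤ D * x i := (div_le_iff₀ (hx i)).1 (hi₃ i)
  have hxi := (hx i).le
  calc k n i ≤ C * t ^ n * y i := hkn n i
    _ ≤ C * t ^ n * (D * x i) := mul_le_mul_of_nonneg_left hyx (by positivity)
    _ = (C * D / c * (t / l) ^ n) * (c * l ^ n * x i) := by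
        have h1 : (t / l) ^ n * l ^ n = t ^ n := by rw [← mul_pow, div_mul_cancel₀ t hl.ne']
        rw [← h1]
        generalize (t / l) ^ n = w
        field_simp
    _ ≤ ε * (c * l ^ n * x i) := mul_le_mul_of_nonneg_right hn (by positivity)
    _ ≤ ε * h n i := mul_le_mul_of_nonneg_left (hhn n i) hε.le

lemma iterate_eq_pow_mulVec {F : Matrix ι ι ℝ} {h : ℕ → ι → ℝ}
    (hh : ∀ n, h (n + 1) = F *ᵥ h n) (n m : ℕ) : h (n + m) = (F ^ m) *ᵥ h n := by
  induction m with
  | zero => simp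
  | succ m ih => rw [← add_assoc, hh, ih, mulVec_mulVec, ← pow_succ']

/-- If a power of `F` is positive, then vectors that grow at most as fast as `F` permits and that
vanish somewhere at each step are negligible. -/
theorem exists_growth_le_of_exists_zero {F : Matrix ι ι ℝ} (hF : ∀ i j, 0 ≤ F i j) {K : ℕ}
    (hK : ∀ i j, 1 ≤ (F ^ K) i j) {k h : ℕ → ι → ℝ}
    (hk : ∀ n i, k (n + 1) i ≤ (F *ᵥ k n) i) (hk0 : ∀ n i, 0 ≤ k n i)
    (hkz : ∀ n, ∃ i, k n i = 0) (hh : ∀ n, h (n + 1) = F *ᵥ h n)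
    (hkh : ∀ i, k 0 i ≤ h 0 i) {ε : ℝ} (hε : 0 < ε) : ∃ n, ∀ i, k n i ≤ ε * h n i := by
  have hkh' : ∀ n i, k n i ≤ h n i := by
    intro n
    induction n with
    | zero => exact hkh
    | succ n ih => exact fun i => (hk n i).trans (hh n ▸ mulVec_le_mulVec_of_nonneg hF ih i)
  have hh0 : ∀ n i, 0 ≤ h n i := fun n i => (hk0 n i).trans (hkh' n i)
  have hkK : ∀ n m i, k (n + m) i ≤ ((F ^ m) *ᵥ k n) i := by
    intro n m
    induction m with
    | zero => simp
    | succ m ih =>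
      intro i
      rw [pow_succ', ← mulVec_mulVec]
      exact (hk (n + m) i).trans (mulVec_le_mulVec_of_nonneg hF ih i)
  obtain ⟨M, hM1, hM⟩ := exists_entry_le (F ^ K)
  set N : ℝ := (Fintype.card ι : ℝ) with hN
  have hN0 : 0 ≤ N := Nat.cast_nonneg _
  set δ : ℝ := (1 + M ^ 2 * N)⁻¹ with hδ
  have hδ0 : 0 < δ := by positivity
  have hδ1 : δ ≤ 1 := inv_le_one_of_one_le₀ (by nlinarith [sq_nonneg M])
  -- Starting at `K + n` makes the entries of `h` comparable, up to the factor `M`, so that the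
  -- entry at the zero of `k` is a proportion at least `δ` of any entry `K` levels later.
  have hstep : ∀ n c, 0 ≤ c → (∀ i, k (K + n) i ≤ c * h (K + n) i) →
      ∀ i, k (K + n + K) i ≤ (c * (1 - δ)) * h (K + n + K) i := by
    intro n c hc hle i
    obtain ⟨j, hj⟩ := hkz (K + n)
    set s := ∑ j, h n j with hs
    have hs0 : 0 ≤ s := Finset.sum_nonneg fun j _ => hh0 n j
    have hb : ∀ j, h (K + n) j ∈ Set.Icc s (M * s) := fun j => by
      rw [add_comm, iterate_eq_pow_mulVec hh]
      exact mulVec_mem_Icc hK hM (hh0 n) j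
    have hbig : h (K + n + K) i ≤ M ^ 2 * N * s := by
      rw [iterate_eq_pow_mulVec hh]
      calc ((F ^ K) *ᵥ h (K + n)) i ≤ M * ∑ j, h (K + n) j :=
            (mulVec_mem_Icc hK hM (hh0 _) i).2
        _ ≤ M * ∑ _j : ι, M * s := by
            gcongr with j
            exact (hb j).2
        _ = M ^ 2 * N * s := by
            rw [Finset.sum_const, Finset.card_univ, nsmul_eq_mul]; ring
    have hδs : δ * h (K + n + K) i ≤ h (K + n) j := by
      refine le_trans ?_ (hb j).1
      rw [hδ, inv_mul_le_iff₀ (by positivity)]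
      nlinarith
    calc k (K + n + K) i ≤ ((F ^ K) *ᵥ k (K + n)) i := hkK _ _ i
      -- The term `j` vanishes on the left, and `(F ^ K) i j ≥ 1` leaves room to subtract `c * h (K
      -- + n) j` on the right.
      _ ≤ ∑ j', ((F ^ K) i j' * (c * h (K + n) j') -
            if j' = j then c * h (K + n) j' else 0) := by
          refine Finset.sum_le_sum fun j' _ => ?_
          split_ifs with hjj
          · subst hjj
            rw [hj, mul_zero]
            have := mul_le_mul_of_nonneg_right (hK i j') (mul_nonneg hc (hh0 (K + n) j'))
            linarith
          · rw [sub_zero]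
            exact mul_le_mul_of_nonneg_left (hle j') (pow_apply_nonneg hF K i j')
      _ = c * h (K + n + K) i - c * h (K + n) j := by
          rw [Finset.sum_sub_distrib, Finset.sum_ite_eq' Finset.univ j, if_pos (Finset.mem_univ j),
            iterate_eq_pow_mulVec hh (K + n) K]
          congr 1
          simp only [mulVec, dotProduct]
          rw [Finset.mul_sum]
          exact Finset.sum_congr rfl fun j' _ => by ring
      _ ≤ c * h (K + n + K) i - c * (δ * h (K + n + K) i) :=
          sub_le_sub_left (mul_le_mul_of_nonneg_left hδs hc) _
      _ = _ := by ring
  have hiter : ∀ m i, k (K + m * K) i ≤ (1 - δ) ^ m * h (K + m * K) i := by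
    intro m
    induction m with
    | zero => intro i; simpa using hkh' K i
    | succ m ih =>
      intro i
      have := hstep (m * K) _ (pow_nonneg (by linarith) m) ih i
      rwa [← pow_succ, add_assoc, ← Nat.succ_mul] at this
  obtain ⟨m, hm⟩ := exists_pow_lt_of_lt_one hε (show 1 - δ < 1 by linarith)
  exact ⟨K + m * K, fun i => (hiter m i).trans (mul_le_mul_of_nonneg_right hm.le (hh0 _ i))⟩

lemma eq_pow_vecMul {F : Matrix ι ι ℝ} {q : ℕ → ι → ℝ}
    (hq : ∀ n, q n = q (n + 1) ᵥ* F) (n m : ℕ) : q n = q (n + m) ᵥ* (F ^ m) := by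
  induction m with
  | zero => simp
  | succ m ih => rw [ih, hq (n + m), vecMul_vecMul, ← pow_succ', add_assoc]

/-- If a power of `F` is positive, the normalized nonnegative solutions of `q n = q (n + 1) F`
dominate each other. -/
theorem le_of_vecMul_recursion {F : Matrix ι ι ℝ} (hF : ∀ i j, 0 ≤ F i j) {K : ℕ}
    (hK : ∀ i j, 1 ≤ (F ^ K) i j) {h : ℕ → ι → ℝ} (hh : ∀ n, h (n + 1) = F *ᵥ h n)
    (hh0 : ∀ i, 0 ≤ h 0 i) {q q' : ℕ → ι → ℝ} (hq : ∀ n, q n = q (n + 1) ᵥ* F)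
    (hq' : ∀ n, q' n = q' (n + 1) ᵥ* F) (hq0 : ∀ n i, 0 ≤ q n i) (hq0' : ∀ n i, 0 ≤ q' n i)
    (hhq : ∀ n, ∑ i, h n i * q n i = 1) (hhq' : ∀ n, ∑ i, h n i * q' n i = 1) (n : ℕ) (i : ι) :
    q' n i ≤ q n i := by
  have hhn : ∀ n i, 0 ≤ h n i := by
    intro n
    induction n with
    | zero => exact hh0
    | succ n ih => exact fun i => hh n ▸ mulVec_nonneg_of_nonneg hF ih i
  obtain ⟨M, hM1, hM⟩ := exists_entry_le (F ^ K)
  -- A Harnack inequality: entries at level `n` are comparable with the sum of the entries at level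
  -- `n + K`, and the normalization compares these sums for `q` and `q'`.
  have hcomp : ∀ q q' : ℕ → ι → ℝ, (∀ n, q n = q (n + 1) ᵥ* F) → (∀ n, q' n = q' (n + 1) ᵥ* F) →
      (∀ n i, 0 ≤ q n i) → (∀ n i, 0 ≤ q' n i) → (∀ n, ∑ i, h n i * q n i = 1) →
      (∀ n, ∑ i, h n i * q' n i = 1) → ∀ n i, (M ^ 2)⁻¹ * q' n i ≤ q n i := by
    intro q q' hq hq' hq0 hq0' hhq hhq' n i
    have hI : ∀ q : ℕ → ι → ℝ, (∀ n, q n = q (n + 1) ᵥ* F) → (∀ n i, 0 ≤ q n i) →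
        q n i ∈ Set.Icc (∑ j, q (n + K) j) (M * ∑ j, q (n + K) j) := by
      intro q hq hq0
      rw [eq_pow_vecMul hq n K, ← mulVec_transpose]
      exact mulVec_mem_Icc (fun i j => hK j i) (fun i j => hM j i) (hq0 _) i
    have hq1 := hI q hq hq0
    have hq1' := hI q' hq' hq0'
    set s := ∑ j, q (n + K) j with hs
    set s' := ∑ j, q' (n + K) j with hs'
    set t := ∑ j, h n j with ht
    have hht : ∀ j, h (n + K) j ∈ Set.Icc t (M * t) := fun j => by
      rw [iterate_eq_pow_mulVec hh]
      exact mulVec_mem_Icc hK hM (hhn n) j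
    have h1 : 1 ≤ M * t * s := by
      rw [← hhq (n + K), hs, Finset.mul_sum]
      exact Finset.sum_le_sum fun j _ => mul_le_mul_of_nonneg_right (hht j).2 (hq0 _ j)
    have h2 : t * s' ≤ 1 := by
      rw [← hhq' (n + K), hs', Finset.mul_sum]
      exact Finset.sum_le_sum fun j _ => mul_le_mul_of_nonneg_right (hht j).1 (hq0' _ j)
    have hs0 : 0 ≤ s := Finset.sum_nonneg fun j _ => hq0 _ j
    have ht0 : 0 < t := by
      have : 0 ≤ t := Finset.sum_nonneg fun j _ => hhn n j
      rcases this.eq_or_lt with h | h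
      · rw [← h] at h1; norm_num at h1
      · exact h
    have h3 : s' ≤ M * s := by
      refine le_of_mul_le_mul_left ?_ ht0
      linarith
    rw [inv_mul_le_iff₀ (by positivity)]
    calc q' n i ≤ M * s' := hq1'.2
      _ ≤ M * (M * s) := mul_le_mul_of_nonneg_left h3 (by linarith)
      _ = M ^ 2 * s := by ring
      _ ≤ M ^ 2 * q n i := mul_le_mul_of_nonneg_left hq1.1 (by positivity)
  set δ : ℝ := (M ^ 2)⁻¹ with hδ
  have hδ0 : 0 < δ := by positivity
  have hδ1 : δ < 1 := inv_lt_one_of_one_lt₀ (by nlinarith)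
  have hiter : ∀ m n i, (1 - (1 - δ) ^ m) * q' n i ≤ q n i := by
    intro m
    induction m with
    | zero => intro n i; simpa using hq0 n i
    | succ m ih =>
      intro n i
      set r := (1 - δ) ^ m with hr
      have hr0 : 0 < r := pow_pos (by linarith) m
      -- The rescaled remainder `(q - (1 - r) q') / r` is again a normalized nonnegative solution,
      -- so `hcomp` applies and improves the deficit from `r` to `r * (1 - δ)`.
      have := hcomp (fun n => r⁻¹ • (q n - (1 - r) • q' n)) q' (fun n => by
          rw [smul_vecMul, sub_vecMul, smul_vecMul, ← hq, ← hq']) hq'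
        (fun n i => by
          have := ih n i
          simp only [Pi.smul_apply, Pi.sub_apply, smul_eq_mul]
          exact mul_nonneg (inv_nonneg.2 hr0.le) (by linarith)) hq0'
        (fun n => by
          simp only [Pi.smul_apply, Pi.sub_apply, smul_eq_mul]
          calc _ = r⁻¹ * (∑ i, h n i * q n i - (1 - r) * ∑ i, h n i * q' n i) := by
                rw [Finset.mul_sum _ _ (1 - r), ← Finset.sum_sub_distrib, Finset.mul_sum]
                exact Finset.sum_congr rfl fun i _ => by ring
            _ = 1 := by rw [hhq, hhq']; field_simp; ring) hhq' n i
      simp only [Pi.smul_apply, Pi.sub_apply, smul_eq_mul] at this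
      rw [le_inv_mul_iff₀ hr0] at this
      rw [pow_succ, ← hr]
      linarith
  have hlim : Filter.Tendsto (fun m : ℕ => (1 - (1 - δ) ^ m) * q' n i) Filter.atTop
      (nhds ((1 - 0) * q' n i)) :=
    ((tendsto_pow_atTop_nhds_zero_of_lt_one (by linarith) (by linarith)).const_sub 1).mul_const _
  have := le_of_tendsto hlim (Filter.Eventually.of_forall fun m => hiter m n i)
  linarith

end Nonneg

end Matrix

/-! ### Topology of the path space and exchange of initial segments -/

namespace BratteliDiagram

variable (B : BratteliDiagram.{u, v})

instance (n : ℕ) : Finite (B.V n) := B.finite_V n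

instance (n : ℕ) : Finite (B.E n) := B.finite_E n

noncomputable instance (n : ℕ) : Fintype (B.V n) := Fintype.ofFinite _

noncomputable instance (n : ℕ) : Fintype (B.E n) := Fintype.ofFinite _

instance : T2Space B.PathSpace :=
  inferInstanceAs (T2Space {x : ∀ n, B.E n // ∀ n, B.r (x n) = B.s (x (n + 1))})

instance : SecondCountableTopology B.PathSpace := by
  have : ∀ n, SecondCountableTopology (B.E n) := fun n =>
    haveI := Finite.to_countable (α := B.E n); inferInstance
  have h : SecondCountableTopology (∀ n, B.E n) := inferInstance
  exact TopologicalSpace.Subtype.secondCountableTopology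
    {x : ∀ n, B.E n | ∀ n, B.r (x n) = B.s (x (n + 1))}

variable {B}

/-- The `n`-th edge of a path. -/
def edge (x : B.PathSpace) (n : ℕ) : B.E n := x.1 n

/-- The path with given edges. -/
def mkPath (f : ∀ n, B.E n) (hf : ∀ n, B.r (f n) = B.s (f (n + 1))) : B.PathSpace := ⟨f, hf⟩

lemma edge_mkPath (f : ∀ n, B.E n) (hf : ∀ n, B.r (f n) = B.s (f (n + 1))) (n : ℕ) :
    edge (mkPath f hf) n = f n := rfl

lemma r_edge (x : B.PathSpace) (n : ℕ) : B.r (edge x n) = B.s (edge x (n + 1)) := x.2 n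

lemma continuous_edge (i : ℕ) : Continuous fun x : B.PathSpace => edge x i :=
  (continuous_apply i).comp continuous_subtype_val

instance : CompactSpace B.PathSpace := by
  have : IsClosed {x : ∀ n, B.E n | ∀ n, B.r (x n) = B.s (x (n + 1))} := by
    rw [Set.ofPred_forall]
    refine isClosed_iInter fun n => ?_
    let f : (∀ n, B.E n) → B.E n × B.E (n + 1) := fun x => (x n, x (n + 1))
    have hf : Continuous f := (continuous_apply n).prodMk (continuous_apply (n + 1))
    exact (isClosed_discrete {p : B.E n × B.E (n + 1) | B.r p.1 = B.s p.2}).preimage hf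
  exact isCompact_iff_compactSpace.1 this.isCompact

lemma nonempty_V (n : ℕ) : Nonempty (B.V n) := by
  induction n with
  | zero => exact ⟨B.root⟩
  | succ n ih =>
    obtain ⟨e, -⟩ := B.s_surjective n ih.some
    exact ⟨B.r e⟩

lemma nonempty_E (n : ℕ) : Nonempty (B.E n) :=
  (B.s_surjective n (nonempty_V n).some).nonempty

/-- Edges are chosen backwards from `e` by surjectivity of `r`; the values after `n` are arbitrary
and get replaced in `exists_path`. -/
lemma exists_path_upto (n : ℕ) (e : B.E n) :
    ∃ x : ∀ i, B.E i, x n = e ∧ ∀ i < n, B.r (x i) = B.s (x (i + 1)) := by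
  classical
  induction n with
  | zero => exact ⟨Function.update (fun i => (nonempty_E i).some) 0 e, by simp, by simp⟩
  | succ n ih =>
    obtain ⟨e', he'⟩ := B.r_surjective n (B.s e)
    obtain ⟨x, hx, hxr⟩ := ih e'
    refine ⟨Function.update x (n + 1) e, by simp, fun i hi => ?_⟩
    rw [Function.update_of_ne (by omega)]
    rcases eq_or_ne i n with rfl | hin
    · rw [Function.update_self, hx, he']
    · rw [Function.update_of_ne (by omega)]
      exact hxr i (by omega)

/-- Every edge lies on an infinite path. -/
theorem exists_path (n : ℕ) (e : B.E n) : ∃ x : B.PathSpace, edge x n = e := by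
  obtain ⟨x, hx, hxr⟩ := exists_path_upto n e
  choose f hf using fun i => B.s_surjective i
  let y : ∀ i, B.E i := fun i =>
    Nat.rec (x 0) (fun i z => if i + 1 ≤ n then x (i + 1) else f (i + 1) (B.r z)) i
  have hys : ∀ i, y (i + 1) = if i + 1 ≤ n then x (i + 1) else f (i + 1) (B.r (y i)) :=
    fun i => rfl
  have hy : ∀ i ≤ n, y i = x i := by
    rintro (_ | i) hi
    · rfl
    · rw [hys, if_pos hi]
  refine ⟨mkPath y fun i => ?_, (hy n le_rfl).trans hx⟩
  by_cases hi : i + 1 ≤ n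
  · rw [hy i (by omega), hy (i + 1) hi]
    exact hxr i hi
  · rw [hys, if_neg hi, hf]

/-- The vertex of level `n` of a path. -/
def vert (x : B.PathSpace) (n : ℕ) : B.V n := B.s (edge x n)

lemma vert_succ (x : B.PathSpace) (n : ℕ) : vert x (n + 1) = B.r (edge x n) := (r_edge x n).symm

lemma exists_vert_eq (n : ℕ) (z : B.V n) : ∃ x : B.PathSpace, vert x n = z := by
  obtain ⟨e, he⟩ := B.s_surjective n z
  obtain ⟨x, hx⟩ := exists_path n e
  exact ⟨x, by rw [vert, hx, he]⟩

/-- The cylinder set of the paths whose first `n` edges are those of `a`. -/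
def cyl (a : B.PathSpace) (n : ℕ) : Set B.PathSpace := {x | ∀ i < n, edge x i = edge a i}

lemma mem_cyl_self (a : B.PathSpace) (n : ℕ) : a ∈ cyl a n := fun _ _ => rfl

lemma cyl_eq_of_mem {a b : B.PathSpace} {n : ℕ} (h : b ∈ cyl a n) : cyl b n = cyl a n := by
  ext x
  exact forall₂_congr fun i hi => by rw [h i hi]

lemma vert_eq_of_mem_cyl {a x : B.PathSpace} {n : ℕ} (h : x ∈ cyl a n) : vert x n = vert a n := by
  cases n with
  | zero => rw [B.eq_root (vert x 0), B.eq_root (vert a 0)]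
  | succ n => rw [vert_succ, vert_succ, h n n.lt_succ_self]

lemma isClopen_edge (i : ℕ) (s : Set (B.E i)) : IsClopen {x : B.PathSpace | edge x i ∈ s} :=
  (isClopen_discrete s).preimage (continuous_edge i)

lemma isClopen_cyl (a : B.PathSpace) (n : ℕ) : IsClopen (cyl a n) := by
  have : cyl a n = ⋂ i ∈ Set.Iio n, {x : B.PathSpace | edge x i ∈ ({edge a i} : Set (B.E i))} := by
    ext x; simp [cyl]
  rw [this]
  exact (Set.finite_Iio n).isClopen_biInter fun i _ => isClopen_edge i _

open Classical in
/-- The path that follows `a` up to level `n`, and `x` from then on, if they meet there. -/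
noncomputable def splice (a : B.PathSpace) (n : ℕ) (x : B.PathSpace) : B.PathSpace :=
  if h : vert a n = vert x n then
    mkPath (fun i => if i < n then edge a i else edge x i) fun i => by
      rcases lt_trichotomy (i + 1) n with hi | rfl | hi
      · rw [if_pos hi, if_pos (by omega)]
        exact r_edge a i
      · rw [if_pos i.lt_succ_self, if_neg (lt_irrefl _), ← vert_succ]
        exact h
      · rw [if_neg (by omega), if_neg (by omega)]
        exact r_edge x i
  -- With this default `splice a n x` always has the tail of `x`, without a hypothesis on vertices.
  else x

lemma splice_apply_of_le (a : B.PathSpace) {n i : ℕ} (x : B.PathSpace) (hi : n ≤ i) :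
    edge (splice a n x) i = edge x i := by
  unfold splice
  split_ifs with h
  · rw [edge_mkPath, if_neg (not_lt.2 hi)]
  · rfl

lemma splice_apply_of_lt {a : B.PathSpace} {n i : ℕ} {x : B.PathSpace}
    (h : vert a n = vert x n) (hi : i < n) : edge (splice a n x) i = edge a i := by
  rw [splice, dif_pos h, edge_mkPath, if_pos hi]

lemma vert_splice (a : B.PathSpace) {n m : ℕ} (x : B.PathSpace) (h : n ≤ m) :
    vert (splice a n x) m = vert x m := by
  rw [vert, vert, splice_apply_of_le a x h]

lemma splice_mem_cyl {a : B.PathSpace} {n : ℕ} {x : B.PathSpace} (h : vert a n = vert x n) :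
    splice a n x ∈ cyl a n := fun _ hi => splice_apply_of_lt h hi

lemma path_ext {x y : B.PathSpace} (h : ∀ i, edge x i = edge y i) : x = y :=
  Subtype.ext (funext h)

open Classical in
/-- The involution of the path space that exchanges the initial segments of length `n` of `a` and
`b`. -/
noncomputable def swapFun (a b : B.PathSpace) (n : ℕ) (x : B.PathSpace) : B.PathSpace :=
  if x ∈ cyl a n then splice b n x else if x ∈ cyl b n then splice a n x else x

lemma swapFun_apply_of_le (a b : B.PathSpace) {n i : ℕ} (x : B.PathSpace) (hi : n ≤ i) :
    edge (swapFun a b n x) i = edge x i := by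
  unfold swapFun
  split_ifs
  · exact splice_apply_of_le b x hi
  · exact splice_apply_of_le a x hi
  · rfl

lemma splice_splice {a b x : B.PathSpace} {n : ℕ}
    (hx : x ∈ cyl a n) : splice a n (splice b n x) = x := by
  have hxa := vert_eq_of_mem_cyl hx
  refine path_ext fun i => ?_
  by_cases hi : i < n
  · rw [splice_apply_of_lt (by rw [vert_splice b x le_rfl, hxa]) hi, hx i hi]
  · rw [splice_apply_of_le _ _ (not_lt.1 hi), splice_apply_of_le _ _ (not_lt.1 hi)]

lemma swapFun_involutive {a b : B.PathSpace} {n : ℕ} (hab : vert a n = vert b n) :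
    Function.Involutive (swapFun a b n) := by
  intro x
  by_cases hxa : x ∈ cyl a n
  · have hbx : vert b n = vert x n := by rw [vert_eq_of_mem_cyl hxa, hab]
    have h1 : swapFun a b n x = splice b n x := if_pos hxa
    have h2 : splice b n x ∈ cyl b n := splice_mem_cyl hbx
    rw [h1, swapFun, if_pos h2]
    -- `h3` can hold only when the two cylinders coincide.
    split_ifs with h3
    · have hcyl : cyl a n = cyl b n := (cyl_eq_of_mem h3).symm.trans (cyl_eq_of_mem h2)
      exact splice_splice (hcyl ▸ hxa)
    · exact splice_splice hxa
  · by_cases hxb : x ∈ cyl b n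
    · have hax : vert a n = vert x n := by rw [vert_eq_of_mem_cyl hxb, hab]
      have h1 : swapFun a b n x = splice a n x := by rw [swapFun, if_neg hxa, if_pos hxb]
      rw [h1, swapFun, if_pos (splice_mem_cyl hax)]
      exact splice_splice hxb
    · have h1 : swapFun a b n x = x := by rw [swapFun, if_neg hxa, if_neg hxb]
      rw [h1, h1]

/-- Each edge of the result depends on just two edges of `x`: the `n`-th, which decides whether the
paths meet, and the `i`-th. -/
lemma continuous_splice (a : B.PathSpace) (n : ℕ) : Continuous (splice a n) := by
  refine Continuous.subtype_mk (f := fun x i => edge (splice a n x) i) (continuous_pi fun i => ?_) _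
  by_cases hi : i < n
  · classical
    have h : ∀ x : B.PathSpace, edge (splice a n x) i = (fun e : B.E n =>
        if vert a n = B.s e then fun _ => edge a i else fun e' => e') (edge x n) (edge x i) := by
      intro x
      beta_reduce
      by_cases hv : vert a n = B.s (edge x n)
      · rw [splice_apply_of_lt hv hi, if_pos hv]
      · rw [splice, dif_neg (show ¬vert a n = vert x n from hv), if_neg hv]
    simp_rw [h]
    exact (continuous_of_discreteTopology (f := fun p : B.E n × B.E i => (fun e : B.E n =>
        if vert a n = B.s e then fun _ => edge a i else fun e' => e') p.1 p.2)).comp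
      ((continuous_edge n).prodMk (continuous_edge i))
  · simp_rw [splice_apply_of_le a _ (not_lt.1 hi)]
    exact continuous_edge i

lemma continuous_swapFun (a b : B.PathSpace) (n : ℕ) : Continuous (swapFun a b n) := by
  classical
  have h : ∀ (c : B.PathSpace) (f g : B.PathSpace → B.PathSpace), Continuous f → Continuous g →
      Continuous fun x => if x ∈ cyl c n then f x else g x := fun c f g hf hg =>
    continuous_if (fun x hx => by
      have : x ∈ frontier (cyl c n) := hx
      rw [(isClopen_cyl c n).frontier_eq] at this
      exact this.elim) hf.continuousOn hg.continuousOn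
  unfold swapFun
  exact h a _ _ (continuous_splice b n) (h b _ _ (continuous_splice a n) continuous_id)

/-- `swapFun` as a homeomorphism. -/
noncomputable def swap (a b : B.PathSpace) (n : ℕ) (hab : vert a n = vert b n) :
    B.PathSpace ≃ₜ B.PathSpace where
  toEquiv := (swapFun_involutive hab).toPerm
  continuous_toFun := continuous_swapFun a b n
  continuous_invFun := continuous_swapFun a b n

lemma swap_apply {a b : B.PathSpace} {n : ℕ} (hab : vert a n = vert b n) (x : B.PathSpace) :
    swap a b n hab x = swapFun a b n x := rfl

lemma swap_preimage_cyl {a b : B.PathSpace} {n : ℕ} (hab : vert a n = vert b n) :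
    swap a b n hab ⁻¹' cyl b n = cyl a n := by
  have h1 : ∀ x ∈ cyl a n, swapFun a b n x ∈ cyl b n := fun x hx => by
    rw [swapFun, if_pos hx]
    exact splice_mem_cyl (by rw [vert_eq_of_mem_cyl hx, hab])
  have h2 : ∀ x ∈ cyl b n, swapFun a b n x ∈ cyl a n := fun x hx => by
    by_cases hxa : x ∈ cyl a n
    · rw [← cyl_eq_of_mem hxa, cyl_eq_of_mem hx]
      exact h1 x hxa
    · rw [swapFun, if_neg hxa, if_pos hx]
      exact splice_mem_cyl (by rw [vert_eq_of_mem_cyl hx, hab])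
  ext x
  refine ⟨fun hx => ?_, h1 x⟩
  rw [← swapFun_involutive hab x]
  exact h2 _ hx

lemma isTopologicalBasis_cyl :
    TopologicalSpace.IsTopologicalBasis {s : Set B.PathSpace | ∃ a n, s = cyl a n} := by
  refine TopologicalSpace.isTopologicalBasis_of_isOpen_of_nhds ?_ ?_
  · rintro _ ⟨a, n, rfl⟩
    exact (isClopen_cyl a n).isOpen
  · intro a U ha hU
    obtain ⟨U', hU', rfl⟩ := isOpen_induced_iff.1 hU
    obtain ⟨I, f, hf, hsub⟩ := isOpen_pi_iff.1 hU' a.1 ha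
    refine ⟨cyl a (I.sup id + 1), ⟨a, _, rfl⟩, mem_cyl_self a _, fun x hx => hsub fun i hi => ?_⟩
    have hxi : edge x i = edge a i := hx i (Nat.lt_succ_of_le (Finset.le_sup (f := id) hi))
    have := (hf i hi).2
    change edge x i ∈ f i
    rw [hxi]
    exact this

lemma measurableSet_cyl (a : B.PathSpace) (n : ℕ) : MeasurableSet (cyl a n) :=
  (isClopen_cyl a n).isOpen.measurableSet

lemma cyl_inter_cyl_of_le {a b : B.PathSpace} {n m : ℕ} (hnm : n ≤ m)
    (h : (cyl a n ∩ cyl b m).Nonempty) : cyl a n ∩ cyl b m = cyl b m := by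
  obtain ⟨x, hxa, hxb⟩ := h
  refine Set.inter_eq_right.2 fun y hy i hi => ?_
  rw [hy i (hi.trans_le hnm), ← hxb i (hi.trans_le hnm), hxa i hi]

/-- Finite measures that agree on cylinder sets are equal. -/
theorem ext_of_cyl {μ ν : Measure B.PathSpace} [IsFiniteMeasure μ]
    (h : ∀ a n, μ (cyl a n) = ν (cyl a n)) : μ = ν := by
  obtain ⟨a⟩ : Nonempty B.PathSpace := ⟨(exists_vert_eq 0 B.root).choose⟩
  refine ext_of_generate_finite {s : Set B.PathSpace | ∃ a n, s = cyl a n} ?_ ?_ ?_ ?_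
  · rw [← isTopologicalBasis_cyl.borel_eq_generateFrom]
    exact BorelSpace.measurable_eq
  · rintro _ ⟨a, n, rfl⟩ _ ⟨b, m, rfl⟩ hne
    rcases le_total n m with hnm | hnm
    · exact ⟨b, m, cyl_inter_cyl_of_le hnm hne⟩
    · rw [Set.inter_comm] at hne ⊢
      exact ⟨a, n, cyl_inter_cyl_of_le hnm hne⟩
  · rintro _ ⟨a, n, rfl⟩
    exact h a n
  · have : cyl a 0 = Set.univ := Set.eq_univ_of_forall fun x i hi => absurd hi i.not_lt_zero
    rw [← this]
    exact h a 0

/-- The exchange of the two segments carries one cylinder to the other. All later consequences of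
invariance pass through this equality. -/
theorem IsTailInvariant.measure_cyl_eq {μ : Measure B.PathSpace} (hμ : B.IsTailInvariant μ)
    {a b : B.PathSpace} {n : ℕ} (hab : vert a n = vert b n) : μ (cyl a n) = μ (cyl b n) := by
  have h := hμ (swap a b n hab).toMeasurableEquiv
    fun x => ⟨n, fun i hi => (swapFun_apply_of_le a b x hi).symm⟩
  have h1 := congrArg (fun ν => ν (cyl b n)) h
  simp only [MeasurableEquiv.map_apply] at h1
  rw [← h1]
  exact congrArg μ (swap_preimage_cyl hab).symm

/-! ### Path counts and the weights of an invariant measure -/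

open Classical in
/-- The number of paths with edges in `A` from the root to a given vertex. -/
noncomputable def count (A : ∀ n, Set (B.E n)) : ∀ n, B.V n → ℕ
  | 0, _ => 1
  | n + 1, z => ∑ e : B.E n with e ∈ A n ∧ B.r e = z, count A n (B.s e)

lemma count_succ (A : ∀ n, Set (B.E n)) (n : ℕ) (z : B.V (n + 1)) :
    count A (n + 1) z =
      ∑ y : B.V n, Set.ncard {e : B.E n | e ∈ A n ∧ B.r e = z ∧ B.s e = y} * count A n y := by
  classical
  rw [count, ← Finset.sum_fiberwise _ (fun e => B.s e)]
  refine Finset.sum_congr rfl fun y _ => ?_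
  rw [Finset.sum_congr rfl fun e he => by rw [(Finset.mem_filter.1 he).2], Finset.sum_const,
    smul_eq_mul, ← Set.ncard_coe_finset]
  congr 2
  ext e
  simp [and_assoc]

lemma count_pos (n : ℕ) (z : B.V n) : 0 < count (fun _ => Set.univ) n z := by
  induction n with
  | zero => exact Nat.one_pos
  | succ n ih =>
    obtain ⟨e, he⟩ := B.r_surjective n z
    exact Finset.sum_pos (fun e _ => ih _) ⟨e, by simp [he]⟩

lemma count_le (A : ∀ n, Set (B.E n)) (n : ℕ) (z : B.V n) :
    count A n z ≤ count (fun _ => Set.univ) n z := by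
  classical
  induction n with
  | zero => exact le_rfl
  | succ n ih =>
    exact (Finset.sum_le_sum fun e _ => ih _).trans
      (Finset.sum_le_sum_of_subset fun e he => by simp_all)

/-- The paths that use edges of `A` up to level `n` and follow `c` between the levels `n` and
`m`. -/
def seg (A : ∀ n, Set (B.E n)) (c : B.PathSpace) (n m : ℕ) : Set B.PathSpace :=
  {x | (∀ i < n, edge x i ∈ A i) ∧ vert x n = vert c n ∧
    ∀ i, n ≤ i → i < m → edge x i = edge c i}

lemma measurableSet_edge (i : ℕ) (s : Set (B.E i)) :
    MeasurableSet {x : B.PathSpace | edge x i ∈ s} := (isClopen_edge i s).isOpen.measurableSet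

lemma measurableSet_seg (A : ∀ n, Set (B.E n)) (c : B.PathSpace) (n m : ℕ) :
    MeasurableSet (seg A c n m) := by
  have : seg A c n m = (⋂ i, ⋂ _ : i < n, {x : B.PathSpace | edge x i ∈ A i}) ∩
      ({x : B.PathSpace | edge x n ∈ B.s ⁻¹' {vert c n}} ∩ ⋂ i, ⋂ _ : n ≤ i, ⋂ _ : i < m,
        {x : B.PathSpace | edge x i ∈ ({edge c i} : Set (B.E i))}) := by
    ext x
    simp [seg, vert]
  rw [this]
  exact .inter (.iInter fun i => .iInter fun _ => measurableSet_edge i _)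
    (.inter (measurableSet_edge n _)
      (.iInter fun i => .iInter fun _ => .iInter fun _ => measurableSet_edge i _))

/-- The induction turns the last free edge into a prescribed one, which reproduces the recursion of
`count`. With `m` fixed, all the pieces end in the same vertex of level `m`, so their cylinders have
equal mass. -/
theorem IsTailInvariant.measure_seg {μ : Measure B.PathSpace} (hμ : B.IsTailInvariant μ)
    (A : ∀ n, Set (B.E n)) (c : B.PathSpace) {n m : ℕ} (hnm : n ≤ m) :
    μ (seg A c n m) = count A n (vert c n) * μ (cyl c m) := by
  classical
  induction n generalizing c with
  | zero =>
    rw [count, Nat.cast_one, one_mul]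
    congr 1
    ext x
    simp [seg, cyl, B.eq_root (vert x 0), B.eq_root (vert c 0)]
  | succ n ih =>
    choose d hd using fun e : B.E n => exists_path n e
    have hD : ∀ e, B.r e = vert c (n + 1) → vert (d e) (n + 1) = vert c (n + 1) := fun e he => by
      rw [vert_succ, hd, he]
    have hDn : ∀ e, B.r e = vert c (n + 1) → edge (splice (d e) (n + 1) c) n = e := fun e he => by
      rw [splice_apply_of_lt (hD e he) n.lt_succ_self, hd]
    have hunion : seg A c (n + 1) m = ⋃ e ∈ ({e : B.E n | e ∈ A n ∧ B.r e = vert c (n + 1)} :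
        Finset (B.E n)), seg A (splice (d e) (n + 1) c) n m := by
      ext x
      simp only [Set.mem_iUnion, Finset.mem_filter, Finset.mem_univ, true_and, exists_prop]
      constructor
      · rintro ⟨h1, h2, h3⟩
        have hr : B.r (edge x n) = vert c (n + 1) := by rw [← vert_succ, h2]
        refine ⟨edge x n, ⟨h1 n n.lt_succ_self, hr⟩, fun i hi => h1 i (by omega), ?_,
          fun i hi him => ?_⟩
        · rw [vert, vert, hDn _ hr]
        · rcases hi.eq_or_lt with rfl | hi
          · rw [hDn _ hr]
          · rw [splice_apply_of_le _ _ hi, h3 i hi him]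
      · rintro ⟨e, ⟨heA, her⟩, h1, -, h3⟩
        have hxe : edge x n = e := by rw [h3 n le_rfl hnm, hDn e her]
        refine ⟨fun i hi => ?_, ?_, fun i hi him => ?_⟩
        · rcases (Nat.lt_succ_iff.1 hi).eq_or_lt with rfl | hi
          · rwa [hxe]
          · exact h1 i hi
        · rw [vert_succ, hxe, her]
        · rw [h3 i (by omega) him, splice_apply_of_le _ _ hi]
    rw [hunion, measure_biUnion_finset ?_ fun e _ => measurableSet_seg _ _ _ _, count,
      Nat.cast_sum, Finset.sum_mul]
    · refine Finset.sum_congr rfl fun e he => ?_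
      obtain ⟨-, her⟩ := (Finset.mem_filter.1 he).2
      rw [ih _ (by omega), hμ.measure_cyl_eq (vert_splice (d e) c hnm), vert, hDn e her]
    · intro e he e' he' hne
      simp only [Finset.coe_filter, Finset.mem_univ, true_and] at he he'
      refine Set.disjoint_left.2 fun x hx hx' => hne ?_
      rw [← hDn e he.2, ← hDn e' he'.2, ← hx.2.2 n le_rfl hnm, ← hx'.2.2 n le_rfl hnm]

/-- The measure of the cylinder sets that end in a given vertex. -/
noncomputable def weight (μ : Measure B.PathSpace) (n : ℕ) (z : B.V n) : ℝ :=
  μ.real (cyl (exists_vert_eq n z).choose n)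

lemma weight_nonneg (μ : Measure B.PathSpace) (n : ℕ) (z : B.V n) : 0 ≤ weight μ n z :=
  measureReal_nonneg

lemma IsTailInvariant.measureReal_cyl {μ : Measure B.PathSpace} (hμ : B.IsTailInvariant μ)
    (a : B.PathSpace) (n : ℕ) : μ.real (cyl a n) = weight μ n (vert a n) := by
  rw [weight, measureReal_def, measureReal_def,
    hμ.measure_cyl_eq (exists_vert_eq n (vert a n)).choose_spec.symm]

lemma IsTailInvariant.sum_count_mul_weight {μ : Measure B.PathSpace} [IsFiniteMeasure μ]
    (hμ : B.IsTailInvariant μ) (A : ∀ n, Set (B.E n)) (n : ℕ) :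
    ∑ z : B.V n, (count A n z : ℝ) * weight μ n z =
      μ.real {x : B.PathSpace | ∀ i < n, edge x i ∈ A i} := by
  choose d hd using fun z : B.V n => exists_vert_eq n z
  have hunion : {x : B.PathSpace | ∀ i < n, edge x i ∈ A i} = ⋃ z : B.V n, seg A (d z) n n := by
    ext x
    simp only [Set.mem_iUnion]
    refine ⟨fun hx => ⟨vert x n, hx, (hd _).symm, fun i hi hi' => by omega⟩, ?_⟩
    rintro ⟨z, hz, -⟩
    exact hz
  rw [hunion, measureReal_iUnion_fintype ?_ fun z => measurableSet_seg _ _ _ _]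
  · refine Finset.sum_congr rfl fun z _ => ?_
    rw [measureReal_def, hμ.measure_seg A (d z) le_rfl, ENNReal.toReal_mul, ENNReal.toReal_natCast,
      ← measureReal_def, hμ.measureReal_cyl, hd]
  · intro z z' hne
    refine Set.disjoint_left.2 fun x hx hx' => hne ?_
    rw [← hd z, ← hd z', ← hx.2.1, ← hx'.2.1]

/-- A cylinder splits according to its next edge; these edges are grouped by their range. -/
lemma IsTailInvariant.weight_eq_sum {μ : Measure B.PathSpace} [IsFiniteMeasure μ]
    (hμ : B.IsTailInvariant μ) (n : ℕ) (z : B.V n) :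
    weight μ n z = ∑ y : B.V (n + 1), weight μ (n + 1) y * B.incidence n y z := by
  classical
  obtain ⟨a, ha⟩ := exists_vert_eq n z
  choose d hd using fun e : B.E n => exists_path n e
  have hD : ∀ e, B.s e = z → vert a n = vert (d e) n := fun e he => by
    rw [ha, vert, hd, he]
  have hDn : ∀ e, edge (splice a n (d e)) n = e := fun e => by
    rw [splice_apply_of_le _ _ le_rfl, hd]
  have hunion : cyl a n = ⋃ e ∈ ({e : B.E n | B.s e = z} : Finset (B.E n)),
      cyl (splice a n (d e)) (n + 1) := by
    ext x
    simp only [Set.mem_iUnion, Finset.mem_filter, Finset.mem_univ, true_and, exists_prop]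
    constructor
    · intro hx
      have hs : B.s (edge x n) = z := by rw [← ha, ← vert_eq_of_mem_cyl hx, vert]
      refine ⟨edge x n, hs, fun i hi => ?_⟩
      rcases (Nat.lt_succ_iff.1 hi).eq_or_lt with rfl | hi
      · rw [hDn]
      · rw [splice_apply_of_lt (hD _ hs) hi, hx i hi]
    · rintro ⟨e, he, hx⟩ i hi
      rw [hx i (by omega), splice_apply_of_lt (hD e he) hi]
  have hz : weight μ n z = μ.real (cyl a n) := by rw [hμ.measureReal_cyl, ha]
  rw [hz, hunion, measureReal_biUnion_finset ?_ fun e _ => measurableSet_cyl _ _,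
    ← Finset.sum_fiberwise _ (fun e => B.r e)]
  · refine Finset.sum_congr rfl fun y _ => ?_
    rw [Finset.sum_congr rfl fun e he => by
      rw [hμ.measureReal_cyl, vert_succ, hDn, (Finset.mem_filter.1 he).2], Finset.sum_const,
      nsmul_eq_mul, mul_comm, incidence, ← Set.ncard_coe_finset]
    congr 3
    ext e
    simp [and_comm]
  · intro e _ e' _ hne
    refine Set.disjoint_left.2 fun x hx hx' => hne ?_
    rw [← hDn e, ← hDn e', ← hx n n.lt_succ_self, ← hx' n n.lt_succ_self]

/-- Labels exist only at positive levels; the weight of the root is recovered from level `1`. -/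
theorem IsInvariantProb.ext_of_weight {μ ν : Measure B.PathSpace} (hμ : B.IsInvariantProb μ)
    (hν : B.IsInvariantProb ν) (h : ∀ n z, weight μ (n + 1) z = weight ν (n + 1) z) : μ = ν := by
  have := hμ.1
  have := hν.1
  refine ext_of_cyl fun a n => ?_
  rw [← ENNReal.toReal_eq_toReal_iff' (measure_ne_top _ _) (measure_ne_top _ _)]
  change μ.real _ = ν.real _
  rw [hμ.2.measureReal_cyl, hν.2.measureReal_cyl]
  cases n with
  | zero => rw [hμ.2.weight_eq_sum, hν.2.weight_eq_sum]; simp_rw [h]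
  | succ n => exact h n _

/-- A set of paths is null if the number of paths that use only its edges is negligible. -/
theorem IsInvariantProb.measure_eq_zero {μ : Measure B.PathSpace} (hμ : B.IsInvariantProb μ)
    (A : ∀ n, Set (B.E n))
    (h : ∀ ε : ℝ, 0 < ε → ∃ n, ∀ z : B.V n,
      (count A n z : ℝ) ≤ ε * count (fun _ => Set.univ) n z) :
    μ {x : B.PathSpace | ∀ n, edge x n ∈ A n} = 0 := by
  have := hμ.1
  rw [← measureReal_eq_zero_iff]
  refine le_antisymm (le_of_forall_pos_le_add fun ε hε => ?_) measureReal_nonneg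
  obtain ⟨n, hn⟩ := h ε hε
  calc μ.real {x : B.PathSpace | ∀ n, edge x n ∈ A n}
      ≤ μ.real {x : B.PathSpace | ∀ i < n, edge x i ∈ A i} :=
        measureReal_mono fun x hx i _ => hx i
    _ = ∑ z : B.V n, (count A n z : ℝ) * weight μ n z := (hμ.2.sum_count_mul_weight A n).symm
    _ ≤ ∑ z : B.V n, ε * ((count (fun _ => Set.univ) n z : ℝ) * weight μ n z) :=
        Finset.sum_le_sum fun z _ => by
          rw [← mul_assoc]
          exact mul_le_mul_of_nonneg_right (hn z) (weight_nonneg μ n z)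
    _ = 0 + ε := by
        rw [← Finset.mul_sum, hμ.2.sum_count_mul_weight]
        simp

end BratteliDiagram

/-! ### Existence of an invariant probability measure -/

/-- A bijection that agrees at each point with one of countably many measure preserving bijections
is measure preserving. -/
theorem MeasureTheory.Measure.map_eq_of_forall_exists {X : Type*} [MeasurableSpace X]
    {μ : Measure X} (T : X ≃ᵐ X) (φ : ℕ → X ≃ᵐ X) (hφ : ∀ i, μ.map (φ i) = μ)
    (hm : ∀ i, MeasurableSet {x | T x = φ i x}) (h : ∀ x, ∃ i, T x = φ i x) :
    μ.map T = μ := by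
  set A := disjointed fun i => {x | T x = φ i x} with hA
  have hAm : ∀ i, MeasurableSet (A i) := fun i => MeasurableSet.disjointed hm i
  have hAd : Pairwise (Function.onFun Disjoint A) := disjoint_disjointed _
  have hAu : ⋃ i, A i = Set.univ := by
    rw [hA, iUnion_disjointed]
    exact Set.eq_univ_of_forall fun x => Set.mem_iUnion.2 (h x)
  have hAT : ∀ i, ∀ x ∈ A i, T x = φ i x := fun i x hx => disjointed_subset _ i hx
  -- On `A i` the maps `T` and `φ i` coincide, so the partitions `A i` and `T '' A i` can be
  -- compared piece by piece.
  have hpre : ∀ i (s : Set X), T ⁻¹' s ∩ A i = φ i ⁻¹' (s ∩ T '' A i) := by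
    intro i s
    ext x
    constructor
    · rintro ⟨hxs, hxA⟩
      rw [Set.mem_preimage, ← hAT i x hxA]
      exact ⟨hxs, Set.mem_image_of_mem T hxA⟩
    · rintro ⟨hxs, y, hyA, hy⟩
      have hxy : y = x := (φ i).injective (by rw [← hAT i y hyA, hy])
      subst hxy
      refine ⟨?_, hyA⟩
      rw [Set.mem_preimage, hy]
      exact hxs
  have hsum : ∀ (C : ℕ → Set X) (s : Set X), (∀ i, MeasurableSet (C i)) → MeasurableSet s →
      Pairwise (Function.onFun Disjoint C) → ⋃ i, C i = Set.univ → μ s = ∑' i, μ (s ∩ C i) := by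
    intro C s hC hs hd hu
    rw [← measure_iUnion (fun i j hij => (hd hij).mono Set.inter_subset_right
      Set.inter_subset_right) fun i => hs.inter (hC i), ← Set.inter_iUnion, hu, Set.inter_univ]
  ext s hs
  rw [T.map_apply, hsum A _ hAm (T.measurable hs) hAd hAu,
    hsum (fun i => T '' A i) s (fun i => T.measurableSet_image.2 (hAm i)) hs
      (fun i j hij => (Set.disjoint_image_iff T.injective).2 (hAd hij))
      (by rw [← Set.image_iUnion, hAu, Set.image_univ, T.surjective.range_eq])]
  refine tsum_congr fun i => ?_
  rw [hpre, ← (φ i).map_apply, hφ]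

/-- A bijection that preserves a set preserves the uniform measure of that set. -/
theorem ProbabilityTheory.map_uniformOn {X : Type*} [MeasurableSpace X]
    [MeasurableSingletonClass X] (T : X ≃ᵐ X) {s : Set X} (hs : s.Finite) (hT : T ⁻¹' s = s) :
    (uniformOn s).map T = uniformOn s := by
  ext t ht
  have hc : ∀ t : Set X, Measure.count (T ⁻¹' t) = Measure.count t := by
    intro t
    rw [← T.image_symm]
    exact Measure.count_injective_image T.symm.injective t
  rw [T.map_apply, uniformOn, cond_apply hs.measurableSet, cond_apply hs.measurableSet]
  congr 1
  conv_lhs => rw [← hT, ← Set.preimage_inter, hc]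

namespace BratteliDiagram

variable {B : BratteliDiagram.{u, v}}

/-- A cylinder is determined by any of its points, so `a` and `b` can be taken in a countable dense
set: countably many exchanges realize the whole tail relation. -/
lemma exists_swap_eq {D : Set B.PathSpace} (hD : Dense D) {x y : B.PathSpace}
    (hxy : B.TailEquiv x y) : ∃ n, ∃ a ∈ D, ∃ b ∈ D, ∃ hab : vert a n = vert b n,
      y = swap a b n hab x := by
  obtain ⟨n, hn⟩ := hxy
  obtain ⟨a, ha, hax⟩ := hD.exists_mem_open (isClopen_cyl x n).isOpen ⟨x, mem_cyl_self x n⟩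
  obtain ⟨b, hb, hby⟩ := hD.exists_mem_open (isClopen_cyl y n).isOpen ⟨y, mem_cyl_self y n⟩
  have hvxy : vert x n = vert y n := congrArg B.s (hn n le_rfl)
  have hab : vert a n = vert b n := by
    rw [vert_eq_of_mem_cyl hax, vert_eq_of_mem_cyl hby, hvxy]
  have hxa : x ∈ cyl a n := cyl_eq_of_mem hax ▸ mem_cyl_self x n
  refine ⟨n, a, ha, b, hb, hab, path_ext fun i => ?_⟩
  rw [swap_apply, swapFun, if_pos hxa]
  by_cases hi : i < n
  · rw [splice_apply_of_lt (by rw [vert_eq_of_mem_cyl hby, hvxy]) hi, hby i hi]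
  · rw [splice_apply_of_le _ _ (not_lt.1 hi)]
    exact (hn i (not_lt.1 hi)).symm

/-- A measure that is invariant under the exchange of initial segments is tail invariant. -/
theorem isTailInvariant_of_swap {μ : Measure B.PathSpace}
    (h : ∀ (a b : B.PathSpace) (n : ℕ) (hab : vert a n = vert b n),
      μ.map (swap a b n hab) = μ) : B.IsTailInvariant μ := by
  intro T hT
  obtain ⟨D, hDc, hD⟩ := TopologicalSpace.exists_countable_dense B.PathSpace
  have := hDc.to_subtype
  let J := {p : ℕ × D × D // vert p.2.1.1 p.1 = vert p.2.2.1 p.1}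
  let ψ : J → B.PathSpace ≃ᵐ B.PathSpace := fun p => (swap _ _ _ p.2).toMeasurableEquiv
  have hex : ∀ x, ∃ p : J, T x = ψ p x := fun x => by
    obtain ⟨n, a, ha, b, hb, hab, hx⟩ := exists_swap_eq hD (hT x)
    exact ⟨⟨(n, ⟨a, ha⟩, ⟨b, hb⟩), hab⟩, hx⟩
  have : Nonempty J := ⟨(hex (exists_vert_eq 0 B.root).choose).choose⟩
  obtain ⟨f, hf⟩ := exists_surjective_nat J
  refine Measure.map_eq_of_forall_exists T (fun i => ψ (f i)) (fun i => h _ _ _ (f i).2)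
    (fun i => measurableSet_eq_fun T.measurable (ψ (f i)).measurable) fun x => ?_
  obtain ⟨p, hp⟩ := hex x
  obtain ⟨i, rfl⟩ := hf p
  exact ⟨i, hp⟩

variable (B) in
/-- Every Bratteli diagram carries an invariant probability measure. -/
theorem exists_isInvariantProb : ∃ μ : Measure B.PathSpace, B.IsInvariantProb μ := by
  obtain ⟨z⟩ : Nonempty B.PathSpace := ⟨(exists_vert_eq 0 B.root).choose⟩
  -- An exchange of segments of length at most `n` permutes the finite set `Z n`, hence preserves
  -- its uniform measure.
  let Z : ℕ → Set B.PathSpace := fun n => {x | ∀ i, n ≤ i → edge x i = edge z i}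
  have hZ : ∀ n, (Z n).Finite := fun n => by
    refine Set.Finite.of_finite_image (f := fun x (i : Fin n) => edge x i) (Set.toFinite _) ?_
    intro x hx y hy hxy
    refine path_ext fun i => ?_
    by_cases hi : i < n
    · exact congrFun hxy ⟨i, hi⟩
    · rw [hx i (not_lt.1 hi), hy i (not_lt.1 hi)]
  let ν : ℕ → ProbabilityMeasure B.PathSpace := fun n =>
    ⟨ProbabilityTheory.uniformOn (Z n),
      ProbabilityTheory.isProbabilityMeasure_uniformOn (hZ n) ⟨z, fun _ _ => rfl⟩⟩
  -- Probability measures on the compact path space form a compact space. Each exchange is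
  -- continuous and preserves `ν n` for large `n`, so it preserves the limit.
  obtain ⟨μ, -, hμ⟩ := isCompact_univ.ultrafilter_le_nhds
    ((Filter.hyperfilter ℕ).map ν) (by simp)
  have hlim : Filter.Tendsto ν (Filter.hyperfilter ℕ) (nhds μ) := hμ
  refine ⟨μ, μ.2, isTailInvariant_of_swap fun a b m hab => ?_⟩
  have hmap := ProbabilityMeasure.tendsto_map_of_tendsto_of_continuous ν μ hlim
    (swap a b m hab).continuous
  have heq : (fun n => (ν n).map (swap a b m hab).continuous.measurable.aemeasurable)
      =ᶠ[Filter.hyperfilter ℕ] ν := by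
    have : ∀ᶠ n in Filter.hyperfilter ℕ, m ≤ n :=
      (Nat.hyperfilter_le_atTop) (Filter.eventually_ge_atTop m)
    filter_upwards [this] with n hn
    refine Subtype.ext ?_
    refine ProbabilityTheory.map_uniformOn (swap a b m hab).toMeasurableEquiv (hZ n) ?_
    ext x
    refine forall₂_congr fun i hi => ?_
    have : edge (swapFun a b m x) i = edge x i := swapFun_apply_of_le a b x (hn.trans hi)
    exact Eq.congr_left this
  have := tendsto_nhds_unique (hmap.congr' heq) hlim
  exact congrArg Subtype.val this

end BratteliDiagram

/-! ### Stationary diagrams: from path counts to matrices -/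

open Matrix in
-- Irreducibility depends only on which entries are positive.
lemma Matrix.IsIrreducible.map_natCast_real {ι : Type*} {F : Matrix ι ι ℕ}
    (hF : (F.map (Nat.cast : ℕ → ℤ)).IsIrreducible) :
    (F.map (Nat.cast : ℕ → ℝ)).IsIrreducible := by
  have h : toQuiver (F.map (Nat.cast : ℕ → ℝ)) = toQuiver (F.map (Nat.cast : ℕ → ℤ)) := by
    unfold toQuiver
    congr 1
    funext i j
    simp
  exact ⟨fun i j => by simp, h ▸ hF.connected⟩

namespace BratteliDiagram

variable {B : BratteliDiagram.{u, v}}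

namespace Stationary

open Matrix

variable {ι : Type w} {F : Matrix ι ι ℕ} (hB : B.Stationary F)

/-- A function on the vertices of level `n + 1`, as a vector indexed by labels. -/
noncomputable def vec (f : ∀ n, B.V n → ℝ) (n : ℕ) (i : ι) : ℝ := f (n + 1) ((hB.label n).symm i)

lemma vec_label (f : ∀ n, B.V n → ℝ) (n : ℕ) (z : B.V (n + 1)) :
    hB.vec f n (hB.label n z) = f (n + 1) z := by
  rw [vec, Equiv.symm_apply_apply]

lemma measure_eq_zero {μ : Measure B.PathSpace} (hμ : B.IsInvariantProb μ)
    (A : ∀ n, Set (B.E n))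
    (h : ∀ ε : ℝ, 0 < ε → ∃ n, ∀ i, hB.vec (fun n z => count A n z) n i ≤
      ε * hB.vec (fun n z => count (fun _ => Set.univ) n z) n i) :
    μ {x : B.PathSpace | ∀ n, edge x n ∈ A n} = 0 :=
  hμ.measure_eq_zero A fun ε hε => by
    obtain ⟨n, hn⟩ := h ε hε
    refine ⟨n + 1, fun z => ?_⟩
    simpa only [vec_label] using hn (hB.label n z)

variable [Fintype ι]

lemma vec_count_succ (A : ∀ n, Set (B.E n)) (M : Matrix ι ι ℕ)
    (hM : ∀ n (x : B.V (n + 2)) (y : B.V (n + 1)),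
      Set.ncard {e : B.E (n + 1) | e ∈ A (n + 1) ∧ B.r e = x ∧ B.s e = y} =
        M (hB.label (n + 1) x) (hB.label n y)) (n : ℕ) :
    hB.vec (fun n z => count A n z) (n + 1) =
      M.map (Nat.cast : ℕ → ℝ) *ᵥ hB.vec (fun n z => count A n z) n := by
  funext i
  simp only [vec, mulVec, dotProduct, count_succ A (n + 1), Nat.cast_sum, Nat.cast_mul, hM,
    Equiv.apply_symm_apply, map_apply]
  rw [← (hB.label n).symm.sum_comp]
  simp only [Equiv.apply_symm_apply]

lemma vec_count_univ_succ (n : ℕ) :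
    hB.vec (fun n z => count (fun _ => Set.univ) n z) (n + 1) =
      F.map (Nat.cast : ℕ → ℝ) *ᵥ hB.vec (fun n z => count (fun _ => Set.univ) n z) n :=
  hB.vec_count_succ _ F (fun n x y => by rw [← hB.incidence_eq]; simp [incidence]) n

lemma vec_weight {μ : Measure B.PathSpace} [IsFiniteMeasure μ] (hμ : B.IsTailInvariant μ)
    (n : ℕ) : hB.vec (weight μ) n = hB.vec (weight μ) (n + 1) ᵥ* F.map (Nat.cast : ℕ → ℝ) := by
  funext i
  rw [vec, hμ.weight_eq_sum, ← (hB.label (n + 1)).symm.sum_comp]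
  simp only [vec, vecMul, dotProduct, hB.incidence_eq, Equiv.apply_symm_apply, map_apply]

lemma sum_vec_count_mul_vec_weight {μ : Measure B.PathSpace} (hμ : B.IsInvariantProb μ) (n : ℕ) :
    ∑ i, hB.vec (fun n z => count (fun _ => Set.univ) n z) n i * hB.vec (weight μ) n i = 1 := by
  have := hμ.1
  have h := hμ.2.sum_count_mul_weight (fun _ => Set.univ) (n + 1)
  rw [← (hB.label n).symm.sum_comp] at h
  simp only [vec, h]
  simp

/-- The paths of a subset of the edges with a stationary incidence matrix `M ≤ F`, `M ≠ F`, form a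
null set. -/
theorem measure_eq_zero_of_le {μ : Measure B.PathSpace} (hμ : B.IsInvariantProb μ)
    (hF : (F.map (Nat.cast : ℕ → ℤ)).IsIrreducible) (A : ∀ n, Set (B.E n)) (M : Matrix ι ι ℕ)
    (hM : ∀ n (x : B.V (n + 2)) (y : B.V (n + 1)),
      Set.ncard {e : B.E (n + 1) | e ∈ A (n + 1) ∧ B.r e = x ∧ B.s e = y} =
        M (hB.label (n + 1) x) (hB.label n y)) (hMF : M ≠ F) :
    μ {x : B.PathSpace | ∀ n, edge x n ∈ A n} = 0 := by
  classical
  have : Nonempty ι := ⟨hB.label 0 (nonempty_V 1).some⟩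
  refine hB.measure_eq_zero hμ A fun ε hε => ?_
  refine hF.map_natCast_real.exists_growth_le (A := M.map Nat.cast) (fun i j => by simp)
    (fun i j => ?_) (fun h => hMF ?_) (hB.vec_count_succ A M hM) hB.vec_count_univ_succ
    (fun i => Nat.cast_pos.2 (count_pos _ _)) hε
  -- `M ≤ F` is automatic, since `M` counts some of the edges counted by `F`.
  · rw [map_apply, map_apply, Nat.cast_le]
    have h1 := hM 0 ((hB.label 1).symm i) ((hB.label 0).symm j)
    have h2 := hB.incidence_eq 0 ((hB.label 1).symm i) ((hB.label 0).symm j)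
    rw [Equiv.apply_symm_apply, Equiv.apply_symm_apply] at h1 h2
    rw [← h1, ← h2]
    exact Set.ncard_le_ncard fun e he => he.2
  · exact Matrix.map_injective Nat.cast_injective h

variable [DecidableEq ι]

lemma pow_pos_of_joined {x : B.V 1} {m : ℕ} {y : B.V (m + 1)} (h : B.Joined x y) :
    0 < (F ^ m) (hB.label m y) (hB.label 0 x) := by
  -- The induction runs over all levels; `False` at level `0` is harmless, as no path from level `1`
  -- reaches it.
  let P : ∀ m, B.V m → Prop := fun m => Nat.casesOn m (fun _ => False)
    fun m y => 0 < (F ^ m) (hB.label m y) (hB.label 0 x)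
  suffices ∀ {m : ℕ} {y : B.V m}, B.Joined x y → P m y from this h
  intro m y h
  induction h with
  | refl => change 0 < (F ^ 0) _ _; simp
  | @step m e _ ih =>
    cases m with
    | zero => exact ih.elim
    | succ m =>
      change 0 < (F ^ (m + 1)) (hB.label (m + 1) (B.r e)) (hB.label 0 x)
      rw [pow_succ', mul_apply]
      refine Finset.sum_pos' (fun _ _ => Nat.zero_le _)
        ⟨hB.label m (B.s e), Finset.mem_univ _, Nat.mul_pos ?_ ih⟩
      rw [← hB.incidence_eq]
      exact (Set.ncard_pos).2 ⟨e, rfl, rfl⟩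

/-- Simplicity at level `1` makes a power of `F` positive; integrality gives the bound `1`. -/
lemma exists_pow_ge_one (hB : B.Stationary F) (h : B.IsSimple) :
    ∃ K, ∀ i j, 1 ≤ (F.map (Nat.cast : ℕ → ℝ) ^ K) i j := by
  obtain ⟨m, hm, hj⟩ := h 1
  obtain ⟨K, rfl⟩ : ∃ K, m = K + 1 := ⟨m - 1, by omega⟩
  refine ⟨K, fun i j => ?_⟩
  have h1 : F.map (Nat.cast : ℕ → ℝ) ^ K = (F ^ K).map Nat.cast :=
    (map_pow (Nat.castRingHom ℝ).mapMatrix F K).symm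
  have h2 := hB.pow_pos_of_joined (hj ((hB.label 0).symm j) ((hB.label K).symm i))
  rw [Equiv.apply_symm_apply, Equiv.apply_symm_apply] at h2
  rw [h1, map_apply]
  exact_mod_cast h2

theorem eq_of_isSimple (hB : B.Stationary F) (h : B.IsSimple) {μ ν : Measure B.PathSpace} (hμ : B.IsInvariantProb μ)
    (hν : B.IsInvariantProb ν) : μ = ν := by
  obtain ⟨K, hK⟩ := hB.exists_pow_ge_one h
  have hle : ∀ μ ν : Measure B.PathSpace, B.IsInvariantProb μ → B.IsInvariantProb ν →
      ∀ n i, hB.vec (weight μ) n i ≤ hB.vec (weight ν) n i := by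
    intro μ ν hμ hν
    have := hμ.1
    have := hν.1
    exact le_of_vecMul_recursion (fun i j => by simp) hK hB.vec_count_univ_succ
      (fun i => Nat.cast_nonneg _) (hB.vec_weight hν.2) (hB.vec_weight hμ.2)
      (fun n i => weight_nonneg _ _ _) (fun n i => weight_nonneg _ _ _)
      (hB.sum_vec_count_mul_vec_weight hν) (hB.sum_vec_count_mul_vec_weight hμ)
  refine hμ.ext_of_weight hν fun n z => ?_
  rw [← hB.vec_label (weight μ), ← hB.vec_label (weight ν)]
  exact le_antisymm (hle μ ν hμ hν n _) (hle ν μ hν hμ n _)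

/-- The counts satisfy only an inequality `k (n + 1) ≤ F k n`, but they vanish at an omitted vertex
on every level. -/
theorem measure_vertexSubdiagram_eq_zero (hB : B.Stationary F) (h : B.IsSimple)
    {μ : Measure B.PathSpace} (hμ : B.IsInvariantProb μ) (S : B.VertexSubdiagram) : μ S.pathSpace = 0 := by
  obtain ⟨K, hK⟩ := hB.exists_pow_ge_one h
  refine hB.measure_eq_zero hμ S.edges fun ε hε => ?_
  refine exists_growth_le_of_exists_zero (F := F.map Nat.cast) (fun i j => by simp) hK
    (fun n i => ?_) (fun n i => Nat.cast_nonneg _) (fun n => ?_) hB.vec_count_univ_succ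
    (fun i => Nat.cast_le.2 (count_le _ _ _)) hε
  · simp only [mulVec, dotProduct, map_apply]
    rw [count_succ, Nat.cast_sum, ← (hB.label n).symm.sum_comp]
    refine Finset.sum_le_sum fun j _ => ?_
    rw [Nat.cast_mul]
    refine mul_le_mul_of_nonneg_right (Nat.cast_le.2 ?_) (Nat.cast_nonneg _)
    have h2 := hB.incidence_eq n ((hB.label (n + 1)).symm i) ((hB.label n).symm j)
    rw [Equiv.apply_symm_apply, Equiv.apply_symm_apply] at h2
    rw [← h2]
    exact Set.ncard_le_ncard fun e he => he.2
  · classical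
    obtain ⟨z, hz⟩ := (Set.ne_univ_iff_exists_notMem _).1 (S.W_ne_univ n)
    refine ⟨hB.label n z, ?_⟩
    rw [Equiv.symm_apply_apply, count, Nat.cast_eq_zero]
    refine Finset.sum_eq_zero fun e he => ?_
    obtain ⟨heS, her⟩ := (Finset.mem_filter.1 he).2
    exact absurd (her ▸ heS.2) hz

end Stationary

end BratteliDiagram

theorem mainTheorem9 (B : BratteliDiagram.{u, v}) {ι : Type w} (F : Matrix ι ι ℕ)
    (hB : B.Stationary F) (hF : (F.map (Nat.cast : ℕ → ℤ)).IsIrreducible) :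
    -- invariant probability measures exist; there is just one when the diagram is simple
    (∃ μ : Measure B.PathSpace, B.IsInvariantProb μ) ∧
    (B.IsSimple → ∃! μ : Measure B.PathSpace, B.IsInvariantProb μ) ∧
    ∀ μ : Measure B.PathSpace, B.IsInvariantProb μ →
      -- proper stationary edge subdiagrams
      (∀ (S : B.EdgeSubdiagram) (F' : Matrix ι ι ℕ), S.IsStationary hB F' → F' ≠ F →
        μ S.pathSpace = 0) ∧
      -- stationary vertex subdiagrams
      (∀ S : B.VertexSubdiagram, S.IsStationary hB → μ S.pathSpace = 0) ∧
      -- arbitrary vertex subdiagrams, when the diagram is simple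
      (B.IsSimple → ∀ S : B.VertexSubdiagram, μ S.pathSpace = 0) := by
  classical
  let := Fintype.ofEquiv _ (hB.label 0)
  obtain ⟨μ₀, hμ₀⟩ := B.exists_isInvariantProb
  refine ⟨⟨μ₀, hμ₀⟩, fun h => ⟨μ₀, hμ₀, fun ν hν => hB.eq_of_isSimple h hν hμ₀⟩, fun μ hμ =>
    ⟨fun S F' hS hne => hB.measure_eq_zero_of_le hμ hF S.edges F' hS hne, ?_,
      fun h => hB.measure_vertexSubdiagram_eq_zero h hμ⟩⟩
  rintro S ⟨W, hW⟩
  have hWlabel : ∀ n (z : B.V (n + 1)), z ∈ S.W (n + 1) ↔ hB.label n z ∈ W := fun n z => by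
    rw [hW]; rfl
  -- The subdiagram keeps exactly the entries of `F` with both labels in `W`.
  refine hB.measure_eq_zero_of_le hμ hF S.edges (fun i j => if i ∈ W ∧ j ∈ W then F i j else 0)
    (fun n x y => ?_) fun hWF => ?_
  · split_ifs with h
    · rw [← hB.incidence_eq, BratteliDiagram.incidence]
      congr 1
      ext e
      refine ⟨fun he => he.2, fun he => ⟨⟨?_, ?_⟩, he⟩⟩
      · rw [hWlabel, he.2]
        exact h.2
      · rw [hWlabel, he.1]
        exact h.1
    · rw [Set.ncard_eq_zero]
      refine Set.eq_empty_of_forall_notMem fun e he => h ?_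
      obtain ⟨⟨hs, hr⟩, rfl, rfl⟩ := he
      exact ⟨(hWlabel _ _).1 hr, (hWlabel _ _).1 hs⟩
  -- An omitted vertex receives an edge of `B`, so its row in `F` is nonzero, whereas the row of the
  -- truncated matrix is zero.
  · obtain ⟨x, hx⟩ := (Set.ne_univ_iff_exists_notMem _).1 (S.W_ne_univ 1)
    obtain ⟨e, he⟩ := B.r_surjective 1 x
    have h0 : 0 < F (hB.label 1 x) (hB.label 0 (B.s e)) := by
      rw [← hB.incidence_eq]
      exact (Set.ncard_pos).2 ⟨e, he, rfl⟩
    have h1 := congrFun (congrFun hWF (hB.label 1 x)) (hB.label 0 (B.s e))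
    beta_reduce at h1
    rw [if_neg fun h => hx ((hWlabel _ _).2 h.1)] at h1
    exact h0.ne h1
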